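/- Let $\mu$ be a finite positive Borel measure on $\mathbb{R}$ whose support is compact and infinite. Let $p_0,p_1,\dots$ be its orthonormal polynomials ($\deg p_\ell=\ell$, positive leading coefficient, $\int p_jp_k\,d\mu=\delta_{jk}$), let $$q_\ell(x)=\int\frac{p_\ell(x)-p_\ell(y)}{x-y}\,d\mu(y)$$ be the second kind polynomials (the difference quotient is read as $p_\ell'(x)$ for $y=x$), and let $K_n(z,w)=\sum_{j=0}^{n-1}p_j(z)p_j(w)$, $z,w\in\mathbb{C}$, be the Christoffel–Darboux kernel. Fix $x_0\in\mathbb{R}$ and put $$\mathcal{J}=\begin{pmatrix}0&-1\\1&0\end{pmatrix},\qquad H_{x_0,\ell}=\begin{pmatrix}p_\ell(x_0)^2&-p_\ell(x_0)q_\ell(x_0)\\-p_\ell(x_0)q_\ell(x_0)&q_\ell(x_0)^2\end{pmatrix}.$$ For $z\in\mathbb{C}$ let $(Q_\ell(z))_{\ell\ge0}$ be the sequence of $2\times2$ matrices with $Q_0(z)=\mathrm{Id}$ and $\mathcal{J}(Q_{\ell+1}(z)-Q_\ell(z))=z\,H_{x_0,\ell}\,Q_\ell(z)$ for all $\ell\ge0$.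 Assume that $\sup_\ell\big(p_\ell(x_0)^2+q_\ell(x_0)^2\big)<\infty$. Then there are positive integers $n_1<n_2<\cdots$ and a bounded measurable $H:[0,1]\to M_2(\mathbb{C})$ with $H(t)\ge0$ (positive semidefinite) for almost every $t\in[0,1]$ such that the following holds. 1. For every $a\in\mathbb{C}$ the canonical system $$\mathcal{J}\,\widetilde Q_a'(t)=a\,H(t)\,\widetilde Q_a(t)\quad\text{for a.e. }t\in[0,1],\qquad\widetilde Q_a(0)=\mathrm{Id},$$ has a unique absolutely continuous solution $\widetilde Q_a:[0,1]\to M_2(\mathbb{C})$, and $Q_{\lfloor tn_k\rfloor}(a/n_k)\to\widetilde Q_a(t)$ as $k\to\infty$, uniformly in $t\in[0,1]$. 2. There is a function $K_H:\mathbb{C}^2\to\mathbb{C}$ such that for all $a,b\in\mathbb{C}$ (including $a=b$) $$\lim_{k\to\infty}\frac1{n_k}K_{n_k}\Big(x_0+\frac a{n_k},\,x_0+\frac b{n_k}\Big)=K_H(a,b),$$ and for $a\ne b$, with $e_1=(1,0)^{\mathrm t}$, $$K_H(a,b)=\frac1{a-b}\det\big(\widetilde Q_a(1)e_1,\ \widetilde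 Q_b(1)e_1\big).$$ 3. Write $\widetilde Q_z(1)e_1=(u_1(z),u_2(z))^{\mathrm t}$ and $E(z)=u_1(z)+iu_2(z)$. Then $E$ is a Hermite–Biehler function: it is entire, has no zeros in $\mathbb{C}^+=\{\mathrm{Im}\,z>0\}$, and satisfies $|E(z)|\ge|E(\overline z)|$ for $z\in\mathbb{C}^+$. The function $(a,b)\mapsto K_H(\overline a,b)$ is the reproducing kernel of the associated de Branges space $B(E)$, which consists of the entire functions $f$ such that $f/E$ and $f^\sharp/E$ belong to the Hardy space $H^2(\mathbb{C}^+)$, where $f^\sharp(z)=\overline{f(\overline z)}$, with inner product $(f,g)_E=\frac1\pi\int_{\mathbb{R}}\overline{f(x)}\,g(x)\,|E(x)|^{-2}\,dx$. That is, for every $a\in\mathbb{C}$ the function $K_H(\overline a,\cdot)$ lies in $B(E)$, and $\big(K_H(\overline a,\cdot),f\big)_E=f(a)$ for all $f\in B(E)$, the integral converging absolutely. -/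

import Mathlib

open MeasureTheory Filter Topology Polynomial Complex
open scoped ENNReal NNReal ComplexConjugate ComplexOrder

namespace CDScaling

noncomputable section

/-! ### Orthonormal polynomials, second kind polynomials, Christoffel-Darboux kernel -/

/-- The monic orthogonal polynomials of `μ`, by the Gram-Schmidt process applied to
`1, x, x ^ 2, …` in `L²(μ)`. -/
def monicOrthPoly (μ : Measure ℝ) : ℕ → ℝ[X]
  | n => X ^ n - ∑ j : Fin n,
      C ((∫ x, x ^ n * (monicOrthPoly μ j).eval x ∂μ) /
          (∫ x, (monicOrthPoly μ j).eval x ^ 2 ∂μ)) * monicOrthPoly μ j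
termination_by n => n
decreasing_by all_goals exact j.2

/-- The orthonormal polynomials `p_n` of `μ`, with positive leading coefficient. -/
def orthPoly (μ : Measure ℝ) (n : ℕ) : ℝ[X] :=
  C (1 / √(∫ x, (monicOrthPoly μ n).eval x ^ 2 ∂μ)) * monicOrthPoly μ n

lemma monicOrthPoly_monic (μ : Measure ℝ) (n : ℕ) :
    (monicOrthPoly μ n).Monic ∧ (monicOrthPoly μ n).natDegree = n := by
  induction n using Nat.strong_induction_on with
  | _ n ih =>
    have hdeg : (∑ j : Fin n, C ((∫ x, x ^ n * (monicOrthPoly μ j).eval x ∂μ) /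
          (∫ x, (monicOrthPoly μ j).eval x ^ 2 ∂μ)) * monicOrthPoly μ j).degree
        < ((n : ℕ) : WithBot ℕ) := by
      refine lt_of_le_of_lt (degree_sum_le _ _) ?_
      refine (Finset.sup_lt_iff (WithBot.bot_lt_coe n)).2 fun j _ => ?_
      refine lt_of_le_of_lt (degree_mul_le_of_le degree_C_le le_rfl) ?_
      rw [zero_add]
      refine lt_of_le_of_lt degree_le_natDegree ?_
      rw [(ih j j.2).2]
      exact WithBot.coe_lt_coe.2 j.2
    have hX : (X ^ n : ℝ[X]).degree = n := degree_X_pow n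
    rw [monicOrthPoly]
    refine ⟨(monic_X_pow n).sub_of_left (by rwa [hX]), ?_⟩
    rw [natDegree_eq_of_degree_eq_some]
    rw [degree_sub_eq_left_of_degree_lt (by rwa [hX]), hX]

lemma integrable_eval {μ : Measure ℝ} [IsFiniteMeasure μ] (hcompact : IsCompact μ.support)
    (P : ℝ[X]) : Integrable (fun x => P.eval x) μ := by
  have h := P.continuous.continuousOn.integrableOn_compact (μ := μ) hcompact
  have hres : μ.restrict μ.support = μ :=
    Measure.restrict_eq_self_of_ae_mem (Measure.support_mem_ae (μ := μ))
  rwa [IntegrableOn, hres] at h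

lemma integral_sq_pos {μ : Measure ℝ} [IsFiniteMeasure μ] (hcompact : IsCompact μ.support)
    (hinf : μ.support.Infinite) {P : ℝ[X]} (hP : P ≠ 0) : 0 < ∫ x, P.eval x ^ 2 ∂μ := by
  have hint : Integrable (fun x => P.eval x ^ 2) μ := by
    exact (integrable_eval hcompact (P ^ 2)).congr (ae_of_all _ fun x => by simp)
  refine lt_of_le_of_ne (integral_nonneg fun x => sq_nonneg _) fun h0 => hinf ?_
  rw [eq_comm, integral_eq_zero_iff_of_nonneg (fun x => sq_nonneg _) hint] at h0
  refine (P.roots.toFinset.finite_toSet).subset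
    (Measure.support_subset_of_isClosed (Finset.isClosed _) ?_)
  filter_upwards [h0] with x hx
  simpa [hP] using hx

lemma integral_monicOrthPoly_mul {μ : Measure ℝ} [IsFiniteMeasure μ]
    (hcompact : IsCompact μ.support) (hinf : μ.support.Infinite) (n : ℕ) :
    ∀ m < n, ∫ x, (monicOrthPoly μ n).eval x * (monicOrthPoly μ m).eval x ∂μ = 0 := by
  induction n using Nat.strong_induction_on with
  | _ n ih =>
    intro m hm
    have hpos := integral_sq_pos hcompact hinf (monicOrthPoly_monic μ m).1.ne_zero
    have hterm : ∀ j : Fin n, Integrable (fun x =>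
        ((∫ x, x ^ n * (monicOrthPoly μ j).eval x ∂μ) /
          (∫ x, (monicOrthPoly μ j).eval x ^ 2 ∂μ)) *
          ((monicOrthPoly μ j).eval x * (monicOrthPoly μ m).eval x)) μ := fun j => by
      simpa using (integrable_eval hcompact (monicOrthPoly μ j * monicOrthPoly μ m)).const_mul
        ((∫ x, x ^ n * (monicOrthPoly μ j).eval x ∂μ) /
          (∫ x, (monicOrthPoly μ j).eval x ^ 2 ∂μ))
    have h1 : ∀ x, (monicOrthPoly μ n).eval x * (monicOrthPoly μ m).eval x
        = x ^ n * (monicOrthPoly μ m).eval x - ∑ j : Fin n,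
          ((∫ x, x ^ n * (monicOrthPoly μ j).eval x ∂μ) /
          (∫ x, (monicOrthPoly μ j).eval x ^ 2 ∂μ)) *
          ((monicOrthPoly μ j).eval x * (monicOrthPoly μ m).eval x) := fun x => by
      conv_lhs => rw [monicOrthPoly]
      simp [eval_finsetSum, sub_mul, Finset.sum_mul, mul_assoc]
    simp_rw [h1]
    rw [integral_sub 
      ((integrable_eval hcompact (X ^ n * monicOrthPoly μ m)).congr
        (ae_of_all _ fun x => by simp))
     
      (integrable_finsetSum _ fun j _ => hterm j), integral_finsetSum _ fun j _ => hterm j]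
    simp_rw [integral_const_mul]
    rw [Finset.sum_eq_single (⟨m, hm⟩ : Fin n)]
    · simp only [← pow_two]
      rw [div_mul_cancel₀ _ hpos.ne', sub_self]
    · intro j _ hj
      have hj' : (j : ℕ) ≠ m := fun h => hj (Fin.ext h)
      rcases lt_or_gt_of_ne hj' with h | h
      · simp_rw [mul_comm ((monicOrthPoly μ j).eval _)]
        rw [ih m hm j h, mul_zero]
      · rw [ih j j.2 m h, mul_zero]
    · simp

/-- The `orthPoly μ n` have the defining properties of the orthonormal polynomials. -/
lemma orthPoly_spec {μ : Measure ℝ} [IsFiniteMeasure μ] (hcompact : IsCompact μ.support)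
    (hinf : μ.support.Infinite) :
    (∀ n, (orthPoly μ n).natDegree = n ∧ 0 < (orthPoly μ n).leadingCoeff) ∧
    ∀ m n, ∫ x, (orthPoly μ m).eval x * (orthPoly μ n).eval x ∂μ = if m = n then 1 else 0 := by
  have hpos : ∀ n, 0 < ∫ x, (monicOrthPoly μ n).eval x ^ 2 ∂μ := fun n =>
    integral_sq_pos hcompact hinf (monicOrthPoly_monic μ n).1.ne_zero
  have hc : ∀ n, 0 < 1 / √(∫ x, (monicOrthPoly μ n).eval x ^ 2 ∂μ) := fun n =>
    one_div_pos.2 (Real.sqrt_pos.2 (hpos n))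
  refine ⟨fun n => ⟨?_, ?_⟩, fun m n => ?_⟩
  · rw [orthPoly, natDegree_C_mul (hc n).ne', (monicOrthPoly_monic μ n).2]
  · rw [orthPoly, leadingCoeff_mul, leadingCoeff_C, (monicOrthPoly_monic μ n).1, mul_one]
    exact hc n
  · have h : ∀ x, (orthPoly μ m).eval x * (orthPoly μ n).eval x
        = (1 / √(∫ x, (monicOrthPoly μ m).eval x ^ 2 ∂μ) *
          (1 / √(∫ x, (monicOrthPoly μ n).eval x ^ 2 ∂μ))) *
          ((monicOrthPoly μ m).eval x * (monicOrthPoly μ n).eval x) := fun x => by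
      simp only [orthPoly, eval_mul, eval_C]; ring
    simp_rw [h]
    rw [integral_const_mul]
    split_ifs with hmn
    · subst hmn
      simp only [← pow_two]
      rw [div_pow, Real.sq_sqrt (hpos m).le]
      have := (hpos m).ne'
      field_simp
    · rcases lt_or_gt_of_ne hmn with h | h
      · simp_rw [mul_comm ((monicOrthPoly μ m).eval _)]
        rw [integral_monicOrthPoly_mul hcompact hinf n m h, mul_zero]
      · rw [integral_monicOrthPoly_mul hcompact hinf m n h, mul_zero]

/-- The second kind polynomials `q_n(x) = ∫ (p_n(x) - p_n(y)) / (x - y) dμ(y)`; the difference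
quotient is continued by `p_n'(x)` to `y = x`. -/
def secondKind (μ : Measure ℝ) (n : ℕ) (x : ℝ) : ℝ :=
  ∫ y, dslope (fun t => (orthPoly μ n).eval t) x y ∂μ

/-- The Christoffel-Darboux kernel `K_n(z, w) = ∑_{j < n} p_j(z) p_j(w)` at complex arguments. -/
def cdKernel (μ : Measure ℝ) (n : ℕ) (z w : ℂ) : ℂ :=
  ∑ j ∈ Finset.range n, aeval z (orthPoly μ j) * aeval w (orthPoly μ j)

/-! ### The discrete canonical system -/

/-- The matrix `𝒥`. -/
def matJ : Matrix (Fin 2) (Fin 2) ℂ := !![0, -1; 1, 0]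

/-- The matrix `H_{x₀,ℓ}`. -/
def discreteH (μ : Measure ℝ) (x₀ : ℝ) (l : ℕ) : Matrix (Fin 2) (Fin 2) ℂ :=
  let p : ℂ := (((orthPoly μ l).eval x₀ : ℝ) : ℂ)
  let q : ℂ := ((secondKind μ l x₀ : ℝ) : ℂ)
  !![p ^ 2, -(p * q); -(p * q), q ^ 2]

/-- The solution of `𝒥 (Q_{ℓ+1} - Q_ℓ) = z H_{x₀,ℓ} Q_ℓ`, `Q_0 = Id`
(see `discreteQ_spec` and `discreteQ_unique`). -/
def discreteQ (μ : Measure ℝ) (x₀ : ℝ) (z : ℂ) : ℕ → Matrix (Fin 2) (Fin 2) ℂ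
  | 0 => 1
  | l + 1 => discreteQ μ x₀ z l - z • (matJ * (discreteH μ x₀ l * discreteQ μ x₀ z l))

lemma matJ_mul_matJ : matJ * matJ = -1 := by
  ext i j; fin_cases i <;> fin_cases j <;> simp [matJ]

lemma discreteQ_spec (μ : Measure ℝ) (x₀ : ℝ) (z : ℂ) (l : ℕ) :
    matJ * (discreteQ μ x₀ z (l + 1) - discreteQ μ x₀ z l)
      = z • (discreteH μ x₀ l * discreteQ μ x₀ z l) := by
  simp [discreteQ, ← mul_assoc, matJ_mul_matJ]

lemma discreteQ_unique (μ : Measure ℝ) (x₀ : ℝ) (z : ℂ) (R : ℕ → Matrix (Fin 2) (Fin 2) ℂ)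
    (h0 : R 0 = 1)
    (h : ∀ l, matJ * (R (l + 1) - R l) = z • (discreteH μ x₀ l * R l)) (l : ℕ) :
    R l = discreteQ μ x₀ z l := by
  induction l with
  | zero => simpa [discreteQ] using h0
  | succ l ih =>
    have h1 := congrArg (fun M => matJ * M) (h l)
    simp only [← mul_assoc, matJ_mul_matJ, mul_smul_comm] at h1
    rw [discreteQ, ← ih, ← mul_assoc, ← h1]
    simp

/-! ### The continuous canonical system on `[0, 1]` -/

/-- `Q` solves `𝒥 Q' = z H Q` on `[0, 1]` with `Q(0) = Id`: it is absolutely continuous and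
satisfies the equation almost everywhere. -/
structure IsCanonicalSolution (H : ℝ → Matrix (Fin 2) (Fin 2) ℂ) (z : ℂ)
    (Q : ℝ → Matrix (Fin 2) (Fin 2) ℂ) : Prop where
  absCont : ∀ i j, AbsolutelyContinuousOnInterval (fun t => Q t i j) 0 1
  eqn : ∀ᵐ t ∂(volume.restrict (Set.Icc (0 : ℝ) 1)), ∃ D : Matrix (Fin 2) (Fin 2) ℂ,
    (∀ i j, HasDerivAt (fun s => Q s i j) (D i j) t) ∧ matJ * D = z • (H t * Q t)
  init : Q 0 = 1

/-! ### De Branges spaces -/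

/-- `f^♯(z) = conj (f (conj z))`. -/
def sharp (f : ℂ → ℂ) (z : ℂ) : ℂ := conj (f (conj z))

/-- The Hardy space `H²` of the open upper half plane. -/
def MemHardyTwo (F : ℂ → ℂ) : Prop :=
  DifferentiableOn ℂ F {z | 0 < z.im} ∧
    ∃ C : ℝ≥0, ∀ y : ℝ, 0 < y → ∫⁻ x : ℝ, ‖F (x + y * I)‖ₑ ^ 2 ≤ C

/-- Hermite-Biehler functions (the inequality is not required to be strict). -/
structure IsHermiteBiehler (E : ℂ → ℂ) : Prop where
  entire : Differentiable ℂ E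
  ne_zero : ∀ z : ℂ, 0 < z.im → E z ≠ 0
  norm_le : ∀ z : ℂ, 0 < z.im → ‖E (conj z)‖ ≤ ‖E z‖

/-- Membership in the de Branges space `B(E)`. -/
def MemDeBranges (E f : ℂ → ℂ) : Prop :=
  Differentiable ℂ f ∧ MemHardyTwo (fun z => f z / E z) ∧ MemHardyTwo (fun z => sharp f z / E z)

/-- The integrand `conj f(x) g(x) / |E(x)|²` of the inner product of `B(E)`. -/
def deBrangesIntegrand (E f g : ℂ → ℂ) (x : ℝ) : ℂ :=
  conj (f x) * g x / ((‖E x‖ ^ 2 : ℝ) : ℂ)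

/-- The inner product `(1/π) ∫ conj f(x) g(x) / |E(x)|² dx` of `B(E)`. -/
def deBrangesInner (E f g : ℂ → ℂ) : ℂ :=
  (1 / (Real.pi : ℂ)) * ∫ x : ℝ, deBrangesIntegrand E f g x

/-- `K` is the reproducing kernel of `B(E)`: `K(z, ·) ∈ B(E)` for every `z`, and
`(K(z, ·), f)_E = f(z)` for all `f ∈ B(E)` (the integral converging absolutely). -/
def IsReproducingKernel (E : ℂ → ℂ) (K : ℂ → ℂ → ℂ) : Prop :=
  ∀ z : ℂ, MemDeBranges E (K z) ∧ ∀ f : ℂ → ℂ, MemDeBranges E f →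
    Integrable (deBrangesIntegrand E (K z) f) ∧ deBrangesInner E (K z) f = f z

/-- The function `E(z) = u₁(1, z) + i u₂(1, z)` with `u(t, z) = Q_z(t) e₁`, for a family of
matrix solutions `Q_z`, `z ∈ ℂ`, of a canonical system on `[0, 1]`. -/
def hermiteBiehlerFun (Q : ℂ → ℝ → Matrix (Fin 2) (Fin 2) ℂ) (z : ℂ) : ℂ :=
  Q z 1 0 0 + I * Q z 1 1 0

/-- `det (A e₁, B e₁)`. -/
def detFirstCols (A B : Matrix (Fin 2) (Fin 2) ℂ) : ℂ :=
  Matrix.det !![A 0 0, B 0 0; A 1 0, B 1 0]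

end

end CDScaling

open CDScaling

/-! The polynomials at `x₀ + z` are read off from the discrete system. Expanding the divided
difference of `p_n` at `x₀` in `p_0, …, p_{n-1}` gives a discrete Volterra equation for `p_n(x₀ +
z)` with coefficients `p_l(x₀) q_n(x₀) - p_n(x₀) q_l(x₀)` (`orthPoly_expansion`). The row `(p_n(x₀),
-q_n(x₀)) Q_n(z) e₁` satisfies the same equation, so the two agree (`aeval_orthPoly_eq_rowVal`).
Since `H_{x₀,l}` has rank one, a Lagrange identity turns this into `(a - b) K_n(x₀ + a, x₀ + b) =
det (Q_n(a) e₁, Q_n(b) e₁)` (`sub_mul_cdKernel`). No recurrence coefficients are needed.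

With `z = a / n` the discrete system is an Euler scheme with step `1 / n` for a canonical system on
`[0, 1]`, with the bounded step Hamiltonian `t ↦ H_{x₀,⌊tn⌋}`. Bounded sequences are weakly compact,
so a subsequence converges weakly to some `H`, which inherits positivity. Weak convergence suffices
for the solutions: the coefficient error is tested only against the fixed limit solution, it is
uniform in `t` by a Lipschitz bound, and Gronwall's inequality absorbs the rest
(`tendsto_discrete_evolution`). This gives the kernel limit for `a ≠ b`; on the diagonal it follows
from the mean value property on a circle.

For the de Branges part, `K_n(z, conj z) ≥ 0` yields `|E^♯| ≤ |E|` in the limit, and `det Q_n = 1`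
excludes common zeros of `u₁` and `u₂`. So `E` has no zeros in the closed upper half plane, and `F₁
= f / E` and `F₂ = f^♯ / E` are continuous up to the real line. There `K_H(a, x) f(x) / |E(x)|²`
equals `(2i)⁻¹ (E(a) F₁(x) - E^♯(a) conj F₂(x)) / (x - a)`, and Cauchy's formula in `H²` gives the
reproducing property (`IsHardyCont.integral_combination`, `IsKernelPair.reproducing`). -/

namespace CDScaling

/-! ### Divided differences of orthonormal polynomials -/

section OrthogonalPolynomials

variable {μ : Measure ℝ} [IsFiniteMeasure μ]

lemma integrable_eval_mul (hcompact : IsCompact μ.support) (P R : ℝ[X]) :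
    Integrable (fun x => P.eval x * R.eval x) μ := by
  simpa using integrable_eval hcompact (P * R)

/-- A polynomial of degree `< n` is the sum of its Fourier expansion in the orthonormal
polynomials. -/
lemma eq_sum_orthPoly (hcompact : IsCompact μ.support) (hinf : μ.support.Infinite) (n : ℕ) :
    ∀ P : ℝ[X], P.degree < n →
      P = ∑ l ∈ Finset.range n, C (∫ y, P.eval y * (orthPoly μ l).eval y ∂μ) * orthPoly μ l := by
  obtain ⟨hdeg, horth⟩ := orthPoly_spec hcompact hinf
  induction n with
  | zero =>
    intro P hP
    have : P = 0 := by
      by_contra h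
      rw [degree_eq_natDegree h] at hP
      simp at hP
    simp [this]
  | succ n ih =>
    intro P hP
    set c : ℝ := P.coeff n / (orthPoly μ n).leadingCoeff with hc
    have hR : (P - C c * orthPoly μ n).degree < n := by
      rw [degree_lt_iff_coeff_zero]
      intro m hm
      rcases hm.eq_or_lt with rfl | hm
      · have hl : (orthPoly μ n).coeff n = (orthPoly μ n).leadingCoeff := by
          rw [leadingCoeff, (hdeg n).1]
        rw [coeff_sub, coeff_C_mul, hl, hc, div_mul_cancel₀ _ (hdeg n).2.ne', sub_self]
      · rw [coeff_sub, coeff_C_mul, coeff_eq_zero_of_degree_lt (hP.trans_le (by exact_mod_cast hm)),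
          coeff_eq_zero_of_natDegree_lt (by rw [(hdeg n).1]; exact hm), mul_zero, sub_self]
    have hint : ∀ l, ∫ y, (P - C c * orthPoly μ n).eval y * (orthPoly μ l).eval y ∂μ =
        (∫ y, P.eval y * (orthPoly μ l).eval y ∂μ) - c * if n = l then 1 else 0 := by
      intro l
      rw [← horth n l, ← integral_const_mul, ← integral_sub (integrable_eval_mul hcompact _ _)
        ((integrable_eval_mul hcompact _ _).const_mul c)]
      congr 1 with y
      simp
      ring
    have hexp := ih _ hR
    -- By induction the remainder lies in the span of `p_0, …, p_{n-1}`, hence is orthogonal to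
    -- `p_n`. This identifies the quotient `c` of leading coefficients with the Fourier coefficient.
    have hcoef : ∫ y, P.eval y * (orthPoly μ n).eval y ∂μ = c := by
      have h0 : ∫ y, (P - C c * orthPoly μ n).eval y * (orthPoly μ n).eval y ∂μ = 0 := by
        rw [hexp]
        have : ∀ y, (∑ l ∈ Finset.range n, C (∫ y, (P - C c * orthPoly μ n).eval y *
            (orthPoly μ l).eval y ∂μ) * orthPoly μ l).eval y * (orthPoly μ n).eval y =
            ∑ l ∈ Finset.range n, (∫ y, (P - C c * orthPoly μ n).eval y *
            (orthPoly μ l).eval y ∂μ) * ((orthPoly μ l).eval y * (orthPoly μ n).eval y) := by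
          intro y
          rw [eval_finsetSum, Finset.sum_mul]
          simp [mul_assoc]
        simp_rw [this]
        rw [integral_finsetSum _ fun l _ => (integrable_eval_mul hcompact _ _).const_mul _]
        refine Finset.sum_eq_zero fun l hl => ?_
        rw [integral_const_mul, horth, if_neg (Finset.mem_range.1 hl).ne, mul_zero]
      rw [hint, if_pos rfl] at h0
      linarith
    rw [Finset.sum_range_succ, hcoef, ← sub_eq_iff_eq_add]
    conv_lhs => rw [hexp]
    refine Finset.sum_congr rfl fun l hl => ?_
    rw [hint, if_neg (Finset.mem_range.1 hl).ne', mul_zero, sub_zero]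

lemma integral_mul_orthPoly_eq_zero (hcompact : IsCompact μ.support)
    (hinf : μ.support.Infinite) {n : ℕ} {P : ℝ[X]} (hP : P.degree < n) :
    ∫ y, (orthPoly μ n).eval y * P.eval y ∂μ = 0 := by
  obtain ⟨-, horth⟩ := orthPoly_spec hcompact hinf
  rw [eq_sum_orthPoly hcompact hinf n P hP]
  have h : ∀ y, (orthPoly μ n).eval y * (∑ l ∈ Finset.range n,
      C (∫ y, P.eval y * (orthPoly μ l).eval y ∂μ) * orthPoly μ l).eval y =
      ∑ l ∈ Finset.range n, (∫ y, P.eval y * (orthPoly μ l).eval y ∂μ) *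
        ((orthPoly μ n).eval y * (orthPoly μ l).eval y) := fun y => by
    simp only [eval_finsetSum, Finset.mul_sum, eval_mul, eval_C, mul_left_comm]
  simp_rw [h]
  rw [integral_finsetSum _ fun l _ => (integrable_eval_mul hcompact _ _).const_mul _]
  refine Finset.sum_eq_zero fun l hl => ?_
  rw [integral_const_mul, horth, if_neg (Finset.mem_range.1 hl).ne', mul_zero]

/-- The divided difference of a polynomial at `a`, as a polynomial. -/
lemma eq_add_mul_divByMonic (P : ℝ[X]) (a : ℝ) :
    P = C (P.eval a) + (X - C a) * (P /ₘ (X - C a)) := by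
  have h := modByMonic_add_div P (X - C a)
  rw [modByMonic_X_sub_C_eq_C_eval] at h
  exact h.symm

lemma dslope_eval (P : ℝ[X]) (a y : ℝ) :
    dslope (fun t => P.eval t) a y = (P /ₘ (X - C a)).eval y := by
  rcases eq_or_ne y a with rfl | hy
  · rw [dslope_same, Polynomial.deriv]
    conv_lhs => rw [eq_add_mul_divByMonic P y]
    simp
  · rw [dslope_of_ne _ hy, slope_def_field]
    conv_lhs => enter [1, 1]; rw [eq_add_mul_divByMonic P a]
    have := sub_ne_zero.2 hy
    simp
    field_simp

lemma degree_divByMonic_orthPoly_lt (hcompact : IsCompact μ.support)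
    (hinf : μ.support.Infinite) (n : ℕ) (a : ℝ) :
    (orthPoly μ n /ₘ (X - C a)).degree < n := by
  obtain ⟨hdeg, -⟩ := orthPoly_spec hcompact hinf
  have hne : orthPoly μ n ≠ 0 := leadingCoeff_ne_zero.1 (hdeg n).2.ne'
  refine (degree_divByMonic_lt _ _ hne (by rw [degree_X_sub_C]; exact zero_lt_one)).trans_le ?_
  rw [degree_eq_natDegree hne, (hdeg n).1]

/-- With `d_n` the divided difference of `p_n` at `x₀`, the products with `y - x₀` cancel in `d_n
p_l - p_n d_l = p_l(x₀) d_n - p_n(x₀) d_l`. Integrating, `p_n d_l` drops out because `deg d_l < l ≤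
n`, and the integrals of `d_n` and `d_l` are the second kind polynomials. -/
lemma integral_divByMonic_orthPoly_mul (hcompact : IsCompact μ.support)
    (hinf : μ.support.Infinite) (x₀ : ℝ) {l n : ℕ} (hl : l ≤ n) :
    ∫ y, (orthPoly μ n /ₘ (X - C x₀)).eval y * (orthPoly μ l).eval y ∂μ =
      (orthPoly μ l).eval x₀ * secondKind μ n x₀ -
        (orthPoly μ n).eval x₀ * secondKind μ l x₀ := by
  simp_rw [secondKind, dslope_eval]
  set dn := orthPoly μ n /ₘ (X - C x₀)
  set dl := orthPoly μ l /ₘ (X - C x₀) with hdl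
  have h1 : ∀ y, dn.eval y * (orthPoly μ l).eval y = (orthPoly μ l).eval x₀ * dn.eval y +
      (orthPoly μ n).eval y * dl.eval y - (orthPoly μ n).eval x₀ * dl.eval y := by
    intro y
    have e1 := congrArg (eval y) (eq_add_mul_divByMonic (orthPoly μ n) x₀)
    have e2 := congrArg (eval y) (eq_add_mul_divByMonic (orthPoly μ l) x₀)
    simp only [eval_add, eval_C, eval_mul, eval_sub, eval_X] at e1 e2
    rw [e1, e2]
    ring
  have h0 : ∫ y, (orthPoly μ n).eval y * dl.eval y ∂μ = 0 :=
    integral_mul_orthPoly_eq_zero hcompact hinf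
      ((degree_divByMonic_orthPoly_lt hcompact hinf l x₀).trans_le (by exact_mod_cast hl))
  simp_rw [h1]
  have i1 := (integrable_eval hcompact dn).const_mul ((orthPoly μ l).eval x₀)
  have i2 := (integrable_eval hcompact dl).const_mul ((orthPoly μ n).eval x₀)
  have i3 := integrable_eval_mul hcompact (orthPoly μ n) dl
  rw [integral_sub (by exact i1.add i3) i2, integral_add i1 i3, h0, integral_const_mul, integral_const_mul,
    add_zero]

/-- Expansion of `p_n` around `x₀`. -/
lemma orthPoly_expansion (hcompact : IsCompact μ.support)
    (hinf : μ.support.Infinite) (x₀ : ℝ) (n : ℕ) (z : ℂ) :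
    aeval (x₀ + z) (orthPoly μ n) = (((orthPoly μ n).eval x₀ : ℝ) : ℂ) +
      z * ∑ l ∈ Finset.range n, ((((orthPoly μ l).eval x₀ : ℝ) : ℂ) * (secondKind μ n x₀ : ℂ) -
        (((orthPoly μ n).eval x₀ : ℝ) : ℂ) * (secondKind μ l x₀ : ℂ)) *
          aeval (x₀ + z) (orthPoly μ l) := by
  have h1 := congrArg (aeval ((x₀ : ℂ) + z)) (eq_add_mul_divByMonic (orthPoly μ n) x₀)
  have h2 := congrArg (aeval ((x₀ : ℂ) + z)) (eq_sum_orthPoly hcompact hinf n _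
    (degree_divByMonic_orthPoly_lt hcompact hinf n x₀))
  rw [h1, map_add, map_mul, h2, map_sum]
  have e : ∀ r : ℝ, aeval ((x₀ : ℂ) + z) (C r) = (r : ℂ) := fun r => by
    rw [aeval_C]; rfl
  rw [e, map_sub, e, aeval_X, add_sub_cancel_left]
  congr 2
  refine Finset.sum_congr rfl fun l hl => ?_
  rw [map_mul, e, integral_divByMonic_orthPoly_mul hcompact hinf x₀ (Finset.mem_range.1 hl).le]
  push_cast
  rfl

end OrthogonalPolynomials

/-! ### The discrete canonical system and the Christoffel–Darboux formula -/

section DiscreteSystem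

variable (μ : Measure ℝ) (x₀ : ℝ)

/-- The row `(p_l(x₀), -q_l(x₀)) Q_l(z) e₁`. -/
noncomputable def rowVal (z : ℂ) (l : ℕ) : ℂ :=
  (((orthPoly μ l).eval x₀ : ℝ) : ℂ) * discreteQ μ x₀ z l 0 0 -
    (secondKind μ l x₀ : ℂ) * discreteQ μ x₀ z l 1 0

lemma discreteQ_succ_apply (z : ℂ) (l : ℕ) (j : Fin 2) :
    discreteQ μ x₀ z (l + 1) 0 j = discreteQ μ x₀ z l 0 j -
      z * (secondKind μ l x₀ : ℂ) * ((((orthPoly μ l).eval x₀ : ℝ) : ℂ) * discreteQ μ x₀ z l 0 j -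
        (secondKind μ l x₀ : ℂ) * discreteQ μ x₀ z l 1 j) ∧
    discreteQ μ x₀ z (l + 1) 1 j = discreteQ μ x₀ z l 1 j -
      z * (((orthPoly μ l).eval x₀ : ℝ) : ℂ) * ((((orthPoly μ l).eval x₀ : ℝ) : ℂ) * discreteQ μ x₀ z l 0 j -
        (secondKind μ l x₀ : ℂ) * discreteQ μ x₀ z l 1 j) := by
  constructor <;>
  · simp [discreteQ, matJ, discreteH, Matrix.vecMul, dotProduct, Fin.sum_univ_two]
    ring

lemma detFirstCols_eq (A B : Matrix (Fin 2) (Fin 2) ℂ) :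
    detFirstCols A B = A 0 0 * B 1 0 - A 1 0 * B 0 0 := by
  simp [detFirstCols, Matrix.det_fin_two]
  ring

/-- Discrete Lagrange identity: one step subtracts `z * rowVal` times the fixed vector `(q_l, p_l)`
from the first column. The term quadratic in the increments vanishes, and the two linear terms add
up to `(a - b)` times the product of the row values. -/
lemma detFirstCols_discreteQ (a b : ℂ) (n : ℕ) :
    detFirstCols (discreteQ μ x₀ a n) (discreteQ μ x₀ b n) =
      (a - b) * ∑ l ∈ Finset.range n, rowVal μ x₀ a l * rowVal μ x₀ b l := by
  simp only [detFirstCols_eq]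
  induction n with
  | zero => simp [discreteQ]
  | succ n ih =>
    rw [Finset.sum_range_succ, mul_add, ← ih, rowVal, rowVal, (discreteQ_succ_apply μ x₀ a n 0).1,
      (discreteQ_succ_apply μ x₀ b n 0).1, (discreteQ_succ_apply μ x₀ a n 0).2,
      (discreteQ_succ_apply μ x₀ b n 0).2]
    ring

/-- Each step multiplies by `1 - z 𝒥 v vᵗ` with `v = (p_l, -q_l)`, which is unipotent because `vᵗ 𝒥
v = 0`. In the limit this keeps the entries of the first column from vanishing together. -/
lemma det_discreteQ (z : ℂ) (n : ℕ) : (discreteQ μ x₀ z n).det = 1 := by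
  rw [Matrix.det_fin_two]
  induction n with
  | zero => simp [discreteQ]
  | succ n ih =>
    rw [← ih, (discreteQ_succ_apply μ x₀ z n 0).1, (discreteQ_succ_apply μ x₀ z n 1).1,
      (discreteQ_succ_apply μ x₀ z n 0).2, (discreteQ_succ_apply μ x₀ z n 1).2]
    ring

lemma discreteQ_conj (z : ℂ) (n : ℕ) (i j : Fin 2) :
    discreteQ μ x₀ (conj z) n i j = conj (discreteQ μ x₀ z n i j) := by
  induction n generalizing i with
  | zero => fin_cases i <;> fin_cases j <;> simp [discreteQ]
  | succ n ih =>
    fin_cases i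
    · have h1 := (discreteQ_succ_apply μ x₀ (conj z) n j).1
      have h2 := (discreteQ_succ_apply μ x₀ z n j).1
      simp only [Fin.zero_eta, h1, h2, ih]
      simp
    · have h1 := (discreteQ_succ_apply μ x₀ (conj z) n j).2
      have h2 := (discreteQ_succ_apply μ x₀ z n j).2
      simp only [Fin.mk_one, h1, h2, ih]
      simp

variable {μ}

/-- The summands are `|p_l(z)|²`. This is the source of the Hermite–Biehler inequality. -/
lemma cdKernel_conj_nonneg (n : ℕ) (z : ℂ) : 0 ≤ cdKernel μ n z (conj z) := by
  refine Finset.sum_nonneg fun l _ => ?_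
  rw [aeval_conj, mul_conj]
  exact_mod_cast normSq_nonneg _

variable [IsFiniteMeasure μ]

/-- Both sides solve the same discrete Volterra equation: the left by `orthPoly_expansion`, the
right by inserting the summed recursion `key` into `rowVal`. The sums run over `l < n` only, so
strong induction determines the solution. -/
lemma aeval_orthPoly_eq_rowVal (hcompact : IsCompact μ.support)
    (hinf : μ.support.Infinite) (z : ℂ) (n : ℕ) :
    aeval (x₀ + z) (orthPoly μ n) = rowVal μ x₀ z n := by
  have key : ∀ n, discreteQ μ x₀ z n 0 0 = 1 - z * ∑ l ∈ Finset.range n,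
      (secondKind μ l x₀ : ℂ) * rowVal μ x₀ z l ∧
      discreteQ μ x₀ z n 1 0 = -(z * ∑ l ∈ Finset.range n,
      (((orthPoly μ l).eval x₀ : ℝ) : ℂ) * rowVal μ x₀ z l) := by
    intro n
    induction n with
    | zero => simp [discreteQ]
    | succ n ih =>
      rw [Finset.sum_range_succ, Finset.sum_range_succ, (discreteQ_succ_apply μ x₀ z n 0).1,
        (discreteQ_succ_apply μ x₀ z n 0).2, ← rowVal]
      constructor
      · linear_combination ih.1
      · linear_combination ih.2
  induction n using Nat.strong_induction_on with
  | _ n ih =>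
    rw [orthPoly_expansion hcompact hinf, rowVal, (key n).1, (key n).2,
      Finset.sum_congr rfl fun l hl => by rw [ih l (Finset.mem_range.1 hl)]]
    simp_rw [sub_mul, Finset.sum_sub_distrib, mul_assoc, mul_left_comm _ (secondKind μ n x₀ : ℂ),
      ← Finset.mul_sum]
    ring

lemma cdKernel_eq_sum (hcompact : IsCompact μ.support)
    (hinf : μ.support.Infinite) (a b : ℂ) (n : ℕ) :
    cdKernel μ n (x₀ + a) (x₀ + b) =
      ∑ l ∈ Finset.range n, rowVal μ x₀ a l * rowVal μ x₀ b l := by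
  simp_rw [cdKernel, aeval_orthPoly_eq_rowVal x₀ hcompact hinf]

lemma sub_mul_cdKernel (hcompact : IsCompact μ.support)
    (hinf : μ.support.Infinite) (a b : ℂ) (n : ℕ) :
    (a - b) * cdKernel μ n (x₀ + a) (x₀ + b) =
      detFirstCols (discreteQ μ x₀ a n) (discreteQ μ x₀ b n) := by
  rw [cdKernel_eq_sum x₀ hcompact hinf, detFirstCols_discreteQ]

end DiscreteSystem

/-! ### Weak compactness of bounded functions -/

section WeakCompactness

variable {α : Type*} [MeasurableSpace α] {ν : Measure α}

/-- A bounded sequence in a separable Hilbert space has a weakly convergent subsequence. -/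
lemma exists_subseq_tendsto_inner {E : Type*} [NormedAddCommGroup E] [InnerProductSpace ℝ E]
    [CompleteSpace E] [TopologicalSpace.SeparableSpace E] {u : ℕ → E} {r : ℝ}
    (hu : ∀ n, ‖u n‖ ≤ r) :
    ∃ (φ : ℕ → ℕ) (v : E), StrictMono φ ∧
      ∀ w, Tendsto (fun k => inner ℝ (u (φ k)) w) atTop (𝓝 (inner ℝ v w)) := by
  obtain ⟨l, -, φ, hφ, hl⟩ := WeakDual.isSeqCompact_closedBall ℝ E 0 r
    (x := fun n => StrongDual.toWeakDual (InnerProductSpace.toDual ℝ E (u n)))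
    (fun n => by simpa using hu n)
  refine ⟨φ, (InnerProductSpace.toDual ℝ E).symm (WeakDual.toStrongDual l), hφ, fun w => ?_⟩
  have h := ((WeakDual.eval_continuous w).tendsto l).comp hl
  rw [InnerProductSpace.toDual_symm_apply]
  exact h

/-- Weak-star compactness of bounded sequences of functions. -/
lemma exists_subseq_tendsto_integral_mul [IsFiniteMeasure ν] [IsSeparable ν] {f : ℕ → α → ℝ}
    (hf : ∀ n, Measurable (f n)) {M : ℝ} (hM : ∀ n t, |f n t| ≤ M) (hM0 : 0 ≤ M) :
    ∃ (φ : ℕ → ℕ) (g : α → ℝ), StrictMono φ ∧ Measurable g ∧ (∀ t, |g t| ≤ M) ∧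
      ∀ h : α → ℝ, MemLp h 2 ν →
        Tendsto (fun k => ∫ t, f (φ k) t * h t ∂ν) atTop (𝓝 (∫ t, g t * h t ∂ν)) := by
  have : Fact ((1 : ℝ≥0∞) ≤ 2) := ⟨one_le_two⟩
  have : Fact ((2 : ℝ≥0∞) ≠ ∞) := ⟨ENNReal.ofNat_ne_top⟩
  have hfL : ∀ n, MemLp (f n) 2 ν := fun n =>
    MemLp.of_bound (hf n).aestronglyMeasurable M (ae_of_all _ (hM n))
  obtain ⟨φ, v, hφ, hv⟩ := exists_subseq_tendsto_inner (u := fun n => (hfL n).toLp (f n))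
    (r := (ν.real Set.univ) ^ (2 : ℝ≥0∞).toReal⁻¹ * M) (fun n => by
      refine Lp.norm_le_of_ae_bound hM0 ?_
      filter_upwards [(hfL n).coeFn_toLp] with t ht
      rw [ht]
      exact hM n t)
  have hw : ∀ h : α → ℝ, MemLp h 2 ν →
      Tendsto (fun k => ∫ t, f (φ k) t * h t ∂ν) atTop (𝓝 (∫ t, v t * h t ∂ν)) := by
    intro h hh
    have hv' := hv (hh.toLp h)
    simp only [L2.inner_def] at hv'
    refine (hv'.congr fun k => ?_).trans_eq ?_
    · refine integral_congr_ae ?_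
      filter_upwards [(hfL (φ k)).coeFn_toLp, hh.coeFn_toLp] with t h1 h2
      rw [h1, h2]
      simp [mul_comm]
    · congr 1
      refine integral_congr_ae ?_
      filter_upwards [hh.coeFn_toLp] with t h2
      rw [h2]
      simp [mul_comm]
  have hvint : Integrable v ν := (Lp.memLp v).integrable one_le_two
  have hset : ∀ s, MeasurableSet s → Tendsto (fun k => ∫ t in s, f (φ k) t ∂ν) atTop
      (𝓝 (∫ t in s, v t ∂ν)) := by
    intro s hs
    have h1 := hw (s.indicator fun _ => 1) (memLp_indicator_const 2 hs 1 (Or.inr (by finiteness)))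
    simp_rw [← Set.indicator_mul_right, mul_one, integral_indicator hs] at h1
    exact h1
  have hfint : ∀ n, Integrable (f n) ν := fun n => (hfL n).integrable one_le_two
  -- Weak convergence in `L²` does not display the pointwise bound; testing against indicators
  -- recovers it almost everywhere.
  have hle : v ≤ᵐ[ν] fun _ => M := by
    refine ae_le_of_forall_setIntegral_le hvint (integrable_const M) fun s hs _ => ?_
    refine le_of_tendsto (hset s hs) (Eventually.of_forall fun k => ?_)
    exact integral_mono (hfint _).integrableOn (integrable_const M)
      fun t => (abs_le.1 (hM _ t)).2
  have hge : (fun _ => -M) ≤ᵐ[ν] v := by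
    refine ae_le_of_forall_setIntegral_le (integrable_const (-M)) hvint fun s hs _ => ?_
    refine ge_of_tendsto (hset s hs) (Eventually.of_forall fun k => ?_)
    exact integral_mono (integrable_const (-M)) (hfint _).integrableOn
      fun t => (abs_le.1 (hM _ t)).1
  -- Truncating the representative makes the bound hold at every point without changing any
  -- integral.
  refine ⟨φ, fun t => max (-M) (min M (v t)), hφ, ?_, fun t => ?_, fun h hh => ?_⟩
  · exact measurable_const.max (measurable_const.min (Lp.stronglyMeasurable v).measurable)
  · rw [abs_le]
    exact ⟨le_max_left _ _, max_le (by linarith) (min_le_left _ _)⟩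
  · refine (hw h hh).trans_eq ?_
    congr 1
    refine integral_congr_ae ?_
    filter_upwards [hle, hge] with t h1 h2
    rw [min_eq_right h1, max_eq_right h2]

end WeakCompactness

/-! ### Gronwall's inequality -/

section Gronwall

/-- An integral Gronwall inequality for bounded measurable functions. -/
lemma gronwall_integral {u : ℝ → ℝ} {η K C : ℝ} (hu : Measurable u) (hK : 0 ≤ K) (hη : 0 ≤ η)
    (hC : ∀ t ∈ Set.Icc (0 : ℝ) 1, |u t| ≤ C)
    (h : ∀ t ∈ Set.Icc (0 : ℝ) 1, u t ≤ η + K * ∫ s in (0 : ℝ)..t, u s) :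
    ∀ t ∈ Set.Icc (0 : ℝ) 1, u t ≤ 2 * η * Real.exp (2 * K) := by
  -- In this weighted supremum norm the operator `u ↦ K ∫ u` has norm at most `1 / 2`, whence `S ≤ η
  -- + S / 2` for nonnegative `S`. The rate `2 * K` produces the exponent in the conclusion.
  set w : ℝ → ℝ := fun t => u t * Real.exp (-(2 * K * t)) with hw
  set A : Set ℝ := w '' Set.Icc 0 1 with hA
  have hAb : BddAbove A := by
    refine ⟨C, ?_⟩
    rintro _ ⟨t, ht, rfl⟩
    have h0 : 0 ≤ C := (abs_nonneg _).trans (hC t ht)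
    have h1 : Real.exp (-(2 * K * t)) ≤ 1 :=
      Real.exp_le_one_iff.2 (neg_nonpos.2 (mul_nonneg (by positivity) ht.1))
    calc u t * Real.exp (-(2 * K * t)) ≤ C * Real.exp (-(2 * K * t)) :=
          mul_le_mul_of_nonneg_right ((le_abs_self _).trans (hC t ht)) (Real.exp_pos _).le
      _ ≤ C * 1 := mul_le_mul_of_nonneg_left h1 h0
      _ = C := mul_one C
  have hne : A.Nonempty := ⟨_, 0, by simp, rfl⟩
  set S := sSup A with hS
  have hle : ∀ t ∈ Set.Icc (0 : ℝ) 1, u t ≤ S * Real.exp (2 * K * t) := by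
    intro t ht
    have h1 : w t ≤ S := le_csSup hAb ⟨t, ht, rfl⟩
    have h2 := mul_le_mul_of_nonneg_right h1 (Real.exp_pos (2 * K * t)).le
    rwa [hw, mul_assoc, ← Real.exp_add, neg_add_cancel, Real.exp_zero, mul_one] at h2
  have hint : ∀ t ∈ Set.Icc (0 : ℝ) 1,
      K * ∫ s in (0 : ℝ)..t, u s ≤ S * (Real.exp (2 * K * t) - 1) / 2 := by
    intro t ht
    have hu' : IntervalIntegrable u volume 0 t := by
      rw [intervalIntegrable_iff_integrableOn_Icc_of_le ht.1]
      refine Measure.integrableOn_of_bounded (M := C) (by simp) hu.aestronglyMeasurable ?_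
      refine (ae_restrict_iff' measurableSet_Icc).2 (ae_of_all _ fun s hs => ?_)
      exact hC s ⟨hs.1, hs.2.trans ht.2⟩
    have h1 : ∫ s in (0 : ℝ)..t, u s ≤ ∫ s in (0 : ℝ)..t, S * Real.exp (2 * K * s) := by
      refine intervalIntegral.integral_mono_on ht.1 hu'
        (Continuous.intervalIntegrable (by fun_prop) _ _) fun s hs => hle s ⟨hs.1, hs.2.trans ht.2⟩
    have h2 : ∫ s in (0 : ℝ)..t, K * (S * Real.exp (2 * K * s)) =
        S * (Real.exp (2 * K * t) - 1) / 2 := by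
      have hd : ∀ s ∈ Set.uIcc 0 t, HasDerivAt (fun s => S / 2 * Real.exp (2 * K * s))
          (K * (S * Real.exp (2 * K * s))) s := by
        intro s _
        have := ((((hasDerivAt_id s).const_mul (2 * K)).exp).const_mul (S / 2))
        refine this.congr_deriv ?_
        simp only [id, mul_one]
        ring
      rw [intervalIntegral.integral_eq_sub_of_hasDerivAt hd
        (Continuous.intervalIntegrable (by fun_prop) _ _)]
      simp
      ring
    rw [← h2, intervalIntegral.integral_const_mul]
    exact mul_le_mul_of_nonneg_left h1 hK
  -- The sign of `u` is not prescribed, so `S` may be negative; `max 0 S` covers both cases.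
  have hS0 : S ≤ max 0 S := le_max_right _ _
  have hSle : S ≤ η + max 0 S / 2 := by
    refine csSup_le hne ?_
    rintro _ ⟨t, ht, rfl⟩
    have h1 := (h t ht).trans (add_le_add_right (hint t ht) η)
    have he : Real.exp (2 * K * t) * Real.exp (-(2 * K * t)) = 1 := by
      rw [← Real.exp_add, add_neg_cancel, Real.exp_zero]
    have hp := Real.exp_pos (-(2 * K * t))
    have hle1 : Real.exp (-(2 * K * t)) ≤ 1 :=
      Real.exp_le_one_iff.2 (neg_nonpos.2 (mul_nonneg (by positivity) ht.1))
    have h2 := mul_le_mul_of_nonneg_right h1 hp.le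
    refine h2.trans ?_
    have h3 : (η + S * (Real.exp (2 * K * t) - 1) / 2) * Real.exp (-(2 * K * t)) =
        η * Real.exp (-(2 * K * t)) + S / 2 * (1 - Real.exp (-(2 * K * t))) := by
      linear_combination S / 2 * he
    rw [h3]
    have h4 : η * Real.exp (-(2 * K * t)) ≤ η := mul_le_of_le_one_right hη hle1
    have h5 : S / 2 * (1 - Real.exp (-(2 * K * t))) ≤
        max 0 S / 2 * (1 - Real.exp (-(2 * K * t))) :=
      mul_le_mul_of_nonneg_right (by linarith) (by linarith)
    have h6 : max 0 S / 2 * (1 - Real.exp (-(2 * K * t))) ≤ max 0 S / 2 :=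
      mul_le_of_le_one_right (by positivity) (by linarith)
    linarith
  have hSη : S ≤ 2 * η := by
    rcases le_total 0 S with h0 | h0
    · rw [max_eq_right h0] at hSle
      linarith
    · linarith
  intro t ht
  refine (hle t ht).trans ?_
  have h1 : Real.exp (2 * K * t) ≤ Real.exp (2 * K) :=
    Real.exp_le_exp.2 (mul_le_of_le_one_right (by positivity) ht.2)
  exact mul_le_mul hSη h1 (Real.exp_pos _).le (by positivity)

end Gronwall

/-! ### Picard series and the discrete Volterra equation -/

section Volterra

variable {𝔸 : Type*} [NormedRing 𝔸] [NormedAlgebra ℂ 𝔸] [CompleteSpace 𝔸] [NormOneClass 𝔸]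

/-- The coefficient of `a ^ k` of the solution of `Q' = a B Q`, `Q(0) = 1`. -/
noncomputable def picardTerm (B : ℝ → 𝔸) : ℕ → ℝ → 𝔸
  | 0 => fun _ => 1
  | k + 1 => fun t => ∫ s in (0 : ℝ)..t, B s * picardTerm B k s

/-- The solution of `Q' = a B Q`, `Q(0) = 1` on `[0, 1]`. -/
noncomputable def evolution (B : ℝ → 𝔸) (a : ℂ) (t : ℝ) : 𝔸 := ∑' k, a ^ k • picardTerm B k t

variable {B : ℝ → 𝔸} {M : ℝ}

omit [NormedAlgebra ℂ 𝔸] [CompleteSpace 𝔸] [NormOneClass 𝔸] in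
lemma intervalIntegrable_mul_continuousOn (hB : StronglyMeasurable B) (hM : ∀ t, ‖B t‖ ≤ M)
    {g : ℝ → 𝔸} {a b : ℝ} (hg : ContinuousOn g (Set.uIcc a b)) :
    IntervalIntegrable (fun s => B s * g s) volume a b := by
  have h1 : IntegrableOn g (Set.uIoc a b) :=
    (hg.integrableOn_compact isCompact_uIcc).mono_set Set.uIoc_subset_uIcc
  rw [intervalIntegrable_iff]
  exact h1.bdd_mul hB.aestronglyMeasurable (ae_of_all _ hM)

omit [CompleteSpace 𝔸] [NormOneClass 𝔸] in
lemma continuous_picardTerm (hB : StronglyMeasurable B) (hM : ∀ t, ‖B t‖ ≤ M) (k : ℕ) :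
    Continuous (picardTerm B k) := by
  induction k with
  | zero => exact continuous_const
  | succ k ih =>
    exact intervalIntegral.continuous_primitive
      (fun a b => intervalIntegrable_mul_continuousOn hB hM ih.continuousOn) 0

omit [CompleteSpace 𝔸] in
-- Iterated integration produces the factorial. Hence the Picard series converges for every `a`,
-- uniformly on `[0, 1]` and locally uniformly in `a`, which gives continuity in `t` and holomorphy
-- in `a`.
lemma norm_picardTerm_le (hM : ∀ t, ‖B t‖ ≤ M) (hM0 : 0 ≤ M) (k : ℕ) :
    ∀ t, 0 ≤ t → ‖picardTerm B k t‖ ≤ (M * t) ^ k / k.factorial := by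
  induction k with
  | zero => intro t _; simp [picardTerm]
  | succ k ih =>
    intro t ht
    have h2 : ∫ s in (0 : ℝ)..t, M * ((M * s) ^ k / k.factorial) =
        (M * t) ^ (k + 1) / (k + 1).factorial := by
      simp_rw [mul_pow, mul_div_assoc, intervalIntegral.integral_const_mul,
        intervalIntegral.integral_div, integral_pow]
      rw [Nat.factorial_succ]
      push_cast
      field_simp
      ring
    rw [picardTerm, ← h2]
    refine intervalIntegral.norm_integral_le_of_norm_le ht (ae_of_all _ fun s hs => ?_)
      (Continuous.intervalIntegrable (by fun_prop) _ _)
    exact (norm_mul_le _ _).trans (mul_le_mul (hM s) (ih s hs.1.le) (norm_nonneg _) hM0)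

omit [CompleteSpace 𝔸] in
lemma norm_pow_smul_picardTerm_le (hM : ∀ t, ‖B t‖ ≤ M) (hM0 : 0 ≤ M)
    {a : ℂ} {r : ℝ} (ha : ‖a‖ ≤ r) (k : ℕ) {t : ℝ} (ht : t ∈ Set.Icc (0 : ℝ) 1) :
    ‖a ^ k • picardTerm B k t‖ ≤ (r * M) ^ k / k.factorial := by
  rw [norm_smul, norm_pow, mul_pow, mul_div_assoc]
  have h1 : (M * t) ^ k ≤ M ^ k :=
    pow_le_pow_left₀ (mul_nonneg hM0 ht.1) (mul_le_of_le_one_right hM0 ht.2) k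
  refine mul_le_mul (pow_le_pow_left₀ (norm_nonneg _) ha k)
    ((norm_picardTerm_le hM hM0 k t ht.1).trans (by gcongr)) (norm_nonneg _) ?_
  exact pow_nonneg ((norm_nonneg _).trans ha) k

lemma continuousOn_evolution (hB : StronglyMeasurable B) (hM : ∀ t, ‖B t‖ ≤ M) (hM0 : 0 ≤ M)
    (a : ℂ) : ContinuousOn (evolution B a) (Set.Icc 0 1) :=
  continuousOn_tsum (fun k => ((continuous_picardTerm hB hM k).const_smul (a ^ k)).continuousOn)
    (Real.summable_pow_div_factorial (‖a‖ * M))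
    fun k _ ht => norm_pow_smul_picardTerm_le hM hM0 le_rfl k ht

lemma differentiable_evolution (hM : ∀ t, ‖B t‖ ≤ M) (hM0 : 0 ≤ M)
    {t : ℝ} (ht : t ∈ Set.Icc (0 : ℝ) 1) : Differentiable ℂ fun a => evolution B a t := by
  intro a
  have h := differentiableOn_tsum_of_summable_norm (F := fun k (z : ℂ) => z ^ k • picardTerm B k t)
    (U := Metric.ball 0 (‖a‖ + 1)) (Real.summable_pow_div_factorial ((‖a‖ + 1) * M))
    (fun k => ((differentiable_id.pow k).smul_const _).differentiableOn) Metric.isOpen_ball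
    (fun k w hw => norm_pow_smul_picardTerm_le hM hM0
      (by simpa using (Metric.mem_ball.1 hw).le) k ht)
  exact h.differentiableAt (Metric.isOpen_ball.mem_nhds (by simp))

/-- Integration against `B` sends `picardTerm B k` to `picardTerm B (k + 1)`, so the Volterra
equation is an index shift in the power series. Dominated convergence permits termwise integration.
-/
lemma evolution_eq (hB : StronglyMeasurable B) (hM : ∀ t, ‖B t‖ ≤ M) (hM0 : 0 ≤ M)
    (a : ℂ) {t : ℝ} (ht : t ∈ Set.Icc (0 : ℝ) 1) :
    evolution B a t = 1 + a • ∫ s in (0 : ℝ)..t, B s * evolution B a s := by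
  have hsub : Set.uIoc 0 t ⊆ Set.Icc 0 1 := by
    rw [Set.uIoc_of_le ht.1]
    exact fun s hs => ⟨hs.1.le, hs.2.trans ht.2⟩
  have hsum : ∀ s ∈ Set.Icc (0 : ℝ) 1, Summable fun k => a ^ k • picardTerm B k s := fun s hs =>
    Summable.of_norm_bounded (Real.summable_pow_div_factorial (‖a‖ * M))
      fun k => norm_pow_smul_picardTerm_le hM hM0 le_rfl k hs
  have h1 : HasSum (fun k => ∫ s in (0 : ℝ)..t, B s * (a ^ k • picardTerm B k s))
      (∫ s in (0 : ℝ)..t, B s * evolution B a s) := by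
    refine intervalIntegral.hasSum_integral_of_dominated_convergence
      (fun k _ => M * ((‖a‖ * M) ^ k / k.factorial)) (fun k => ?_) (fun k => ?_) ?_ ?_ ?_
    · exact (hB.aestronglyMeasurable).mul
        ((continuous_picardTerm hB hM k).const_smul (a ^ k)).aestronglyMeasurable
    · exact ae_of_all _ fun s hs => (norm_mul_le _ _).trans (mul_le_mul (hM s)
        (norm_pow_smul_picardTerm_le hM hM0 le_rfl k (hsub hs)) (norm_nonneg _) hM0)
    · exact ae_of_all _ fun s _ => (Real.summable_pow_div_factorial (‖a‖ * M)).mul_left M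
    · exact intervalIntegrable_const
    · exact ae_of_all _ fun s hs => (hsum s (hsub hs)).hasSum.mul_left _
  rw [evolution, (hsum t ht).tsum_eq_zero_add, ← h1.tsum_eq, ← tsum_const_smul'']
  simp only [pow_zero, one_smul, picardTerm, mul_smul_comm, intervalIntegral.integral_smul,
    smul_smul, pow_succ']

omit [CompleteSpace 𝔸] [NormOneClass 𝔸] in
lemma norm_integral_mul_sub_le (hB : StronglyMeasurable B) (hM : ∀ t, ‖B t‖ ≤ M) (hM0 : 0 ≤ M)
    {g : ℝ → 𝔸} {C : ℝ} (hg : ContinuousOn g (Set.Icc 0 1))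
    (hC : ∀ t ∈ Set.Icc (0 : ℝ) 1, ‖g t‖ ≤ C) {s t : ℝ} (hs : s ∈ Set.Icc (0 : ℝ) 1)
    (ht : t ∈ Set.Icc (0 : ℝ) 1) :
    ‖(∫ x in (0 : ℝ)..t, B x * g x) - ∫ x in (0 : ℝ)..s, B x * g x‖ ≤ M * C * |t - s| := by
  have h01 : (0 : ℝ) ∈ Set.Icc (0 : ℝ) 1 := by simp
  rw [intervalIntegral.integral_interval_sub_left
    (intervalIntegrable_mul_continuousOn hB hM (hg.mono (Set.uIcc_subset_Icc h01 ht)))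
    (intervalIntegrable_mul_continuousOn hB hM (hg.mono (Set.uIcc_subset_Icc h01 hs)))]
  refine intervalIntegral.norm_integral_le_of_norm_le_const fun x hx => ?_
  exact (norm_mul_le _ _).trans (mul_le_mul (hM x)
    (hC x (Set.uIcc_subset_Icc hs ht (Set.uIoc_subset_uIcc hx))) (norm_nonneg _) hM0)

/-- The integral of a step function. -/
lemma integral_floor_mul {E : Type*} [NormedAddCommGroup E] [NormedSpace ℝ E] [CompleteSpace E]
    (F : ℕ → E) {N : ℕ} (hN : 0 < N) (m : ℕ) :
    IntervalIntegrable (fun s : ℝ => F ⌊s * N⌋₊) volume 0 (m / N) ∧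
    ∫ s in (0 : ℝ)..(m / N), F ⌊s * N⌋₊ = (N : ℝ)⁻¹ • ∑ l ∈ Finset.range m, F l := by
  have hN' : (0 : ℝ) < N := by exact_mod_cast hN
  have hle : ∀ l : ℕ, (l : ℝ) / N ≤ ((l + 1 : ℕ) : ℝ) / N := fun l => by
    gcongr
    simp
  have hEq : ∀ l : ℕ, Set.EqOn (fun s : ℝ => F ⌊s * N⌋₊) (fun _ => F l)
      (Set.Ioo ((l : ℝ) / N) (((l + 1 : ℕ) : ℝ) / N)) := fun l s hs => by
    have h1 : ⌊s * N⌋₊ = l := by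
      rw [Nat.floor_eq_iff (by have := (div_nonneg l.cast_nonneg hN'.le).trans hs.1.le; positivity)]
      have h1 := (div_lt_iff₀ hN').1 hs.1
      have h2 := (lt_div_iff₀ hN').1 hs.2
      push_cast at h2
      exact ⟨h1.le, h2⟩
    simp [h1]
  -- The floor jumps at the right endpoint, which belongs to the interval but is a null set.
  have hae : ∀ l : ℕ, ∀ᵐ s : ℝ, s ∈ Set.uIoc ((l : ℝ) / N) (((l + 1 : ℕ) : ℝ) / N) →
      F ⌊s * N⌋₊ = F l := fun l => by
    have h0 : ∀ᵐ s : ℝ, s ≠ ((l + 1 : ℕ) : ℝ) / N := by simp [ae_iff, measure_singleton]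
    filter_upwards [h0] with s h0 hs
    rw [Set.uIoc_of_le (hle l)] at hs
    exact hEq l ⟨hs.1, lt_of_le_of_ne hs.2 h0⟩
  have hint : ∀ l : ℕ, IntervalIntegrable (fun s : ℝ => F ⌊s * N⌋₊) volume ((l : ℝ) / N)
      (((l + 1 : ℕ) : ℝ) / N) := fun l => by
    refine (intervalIntegrable_const (c := F l)).congr_ae ?_
    refine (ae_restrict_iff' measurableSet_uIoc).2 ?_
    filter_upwards [hae l] with s hs h
    exact (hs h).symm
  have hval : ∀ l : ℕ, ∫ s in ((l : ℝ) / N)..(((l + 1 : ℕ) : ℝ) / N), F ⌊s * N⌋₊ =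
      (N : ℝ)⁻¹ • F l := fun l => by
    rw [intervalIntegral.integral_congr_ae (hae l), intervalIntegral.integral_const]
    congr 1
    push_cast
    field_simp
    ring
  induction m with
  | zero => simp
  | succ m ih =>
    refine ⟨ih.1.trans (hint m), ?_⟩
    rw [← intervalIntegral.integral_add_adjacent_intervals ih.1 (hint m), ih.2, hval,
      Finset.sum_range_succ, smul_add]

omit [CompleteSpace 𝔸] [NormOneClass 𝔸] in
lemma discrete_eq_sum {b P : ℕ → 𝔸} {z : ℂ} (h0 : P 0 = 1)
    (hP : ∀ l, P (l + 1) = P l + z • (b l * P l)) (n : ℕ) :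
    P n = 1 + z • ∑ l ∈ Finset.range n, b l * P l := by
  induction n with
  | zero => simp [h0]
  | succ n ih => rw [hP, Finset.sum_range_succ, smul_add, ← add_assoc, ← ih]

omit [CompleteSpace 𝔸] in
-- Each step multiplies the norm by at most `1 + ‖z‖ M ≤ exp (‖z‖ M)`. For `z = a / N` and indices
-- up to `N` the bound `exp (‖a‖ M)` no longer depends on `N`.
lemma norm_discrete_le {b P : ℕ → 𝔸} {z : ℂ} (hb : ∀ l, ‖b l‖ ≤ M) (h0 : P 0 = 1)
    (hP : ∀ l, P (l + 1) = P l + z • (b l * P l)) (n : ℕ) :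
    ‖P n‖ ≤ Real.exp (n * (‖z‖ * M)) := by
  induction n with
  | zero => simp [h0]
  | succ n ih =>
    rw [hP]
    calc ‖P n + z • (b n * P n)‖ ≤ ‖P n‖ + ‖z‖ * (M * ‖P n‖) := by
          refine (norm_add_le _ _).trans (add_le_add le_rfl ?_)
          rw [norm_smul]
          gcongr
          exact (norm_mul_le _ _).trans (by gcongr; exact hb n)
      _ = (‖z‖ * M + 1) * ‖P n‖ := by ring
      _ ≤ Real.exp (‖z‖ * M) * Real.exp (n * (‖z‖ * M)) := by
          gcongr
          exact Real.add_one_le_exp _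
      _ = _ := by
          rw [← Real.exp_add]
          congr 1
          push_cast
          ring

end Volterra

/-! ### Convergence of the Euler scheme, and uniqueness -/

section VolterraConvergence

/-- Pointwise convergence of uniformly Lipschitz functions on `[0, 1]` is uniform. -/
lemma eventually_forall_norm_lt_of_lipschitz {E : Type*} [NormedAddCommGroup E]
    {Φ : ℕ → ℝ → E} {L : ℝ} (hL0 : 0 ≤ L)
    (hL : ∀ k, ∀ s ∈ Set.Icc (0 : ℝ) 1, ∀ t ∈ Set.Icc (0 : ℝ) 1,
      ‖Φ k t - Φ k s‖ ≤ L * |t - s|)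
    (hlim : ∀ t ∈ Set.Icc (0 : ℝ) 1, Tendsto (fun k => Φ k t) atTop (𝓝 0)) {ε : ℝ} (hε : 0 < ε) :
    ∀ᶠ k in atTop, ∀ t ∈ Set.Icc (0 : ℝ) 1, ‖Φ k t‖ < ε := by
  -- On a grid of mesh `1 / m` the Lipschitz bound costs at most `L / m ≤ ε / 2`; the finitely many
  -- grid points cost the other half.
  obtain ⟨m, hm⟩ := exists_nat_gt (2 * L / ε)
  have hm0 : (0 : ℝ) < m := (by positivity : (0 : ℝ) ≤ 2 * L / ε).trans_lt hm
  have hgrid : ∀ j ∈ Finset.range (m + 1), ∀ᶠ k in atTop, ‖Φ k ((j : ℝ) / m)‖ < ε / 2 := by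
    intro j hj
    have hj' : (j : ℝ) ≤ m := by exact_mod_cast Nat.lt_succ_iff.1 (Finset.mem_range.1 hj)
    have h := (hlim ((j : ℝ) / m) ⟨by positivity, (div_le_one hm0).2 hj'⟩).norm
    rw [norm_zero] at h
    exact h.eventually_lt_const (by positivity)
  filter_upwards [(Filter.eventually_all_finset _).2 hgrid] with k hk t ht
  have ht0 : 0 ≤ t * m := mul_nonneg ht.1 hm0.le
  have h1 := Nat.floor_le ht0
  have h2 := Nat.lt_floor_add_one (t * m)
  have hfl : ⌊t * m⌋₊ ≤ m := by
    have : t * m ≤ m := mul_le_of_le_one_left hm0.le ht.2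
    exact_mod_cast h1.trans this
  have hk' := hk ⌊t * m⌋₊ (Finset.mem_range.2 (Nat.lt_succ_of_le hfl))
  have hs : ((⌊t * m⌋₊ : ℕ) : ℝ) / m ∈ Set.Icc (0 : ℝ) 1 :=
    ⟨by positivity, (div_le_one hm0).2 (by exact_mod_cast hfl)⟩
  have habs : |t - (⌊t * m⌋₊ : ℝ) / m| ≤ 1 / m := by
    have e : t - (⌊t * m⌋₊ : ℝ) / m = (t * m - ⌊t * m⌋₊) / m := by
      field_simp
    rw [e, abs_of_nonneg (div_nonneg (by linarith) hm0.le)]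
    gcongr
    linarith
  have h3 := hL k _ hs t ht
  have h4 : L * |t - (⌊t * m⌋₊ : ℝ) / m| ≤ ε / 2 := by
    refine (mul_le_mul_of_nonneg_left habs hL0).trans ?_
    rw [mul_one_div, div_le_iff₀ hm0]
    rw [div_lt_iff₀ hε] at hm
    linarith
  calc ‖Φ k t‖ = ‖(Φ k t - Φ k ((⌊t * m⌋₊ : ℝ) / m)) + Φ k ((⌊t * m⌋₊ : ℝ) / m)‖ := by
        rw [sub_add_cancel]
    _ ≤ ‖Φ k t - Φ k ((⌊t * m⌋₊ : ℝ) / m)‖ + ‖Φ k ((⌊t * m⌋₊ : ℝ) / m)‖ := norm_add_le _ _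
    _ < ε := by linarith

variable {𝔸 : Type*} [NormedRing 𝔸] [NormedAlgebra ℂ 𝔸] [CompleteSpace 𝔸] [NormOneClass 𝔸]
  {B : ℝ → 𝔸} {M : ℝ}

/-- The solution of the discrete system with the coefficients `b`, run with step `1 / N`, converges
to the solution of the continuous system, if the step functions of `b` converge weakly. -/
lemma tendsto_discrete_evolution (hB : StronglyMeasurable B) (hM : ∀ t, ‖B t‖ ≤ M) {b : ℕ → 𝔸}
    (hb : ∀ l, ‖b l‖ ≤ M) {n : ℕ → ℕ} (hn : Tendsto n atTop atTop) (hn0 : ∀ k, 0 < n k)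
    (hweak : ∀ g : ℝ → 𝔸, ContinuousOn g (Set.Icc 0 1) → ∀ t ∈ Set.Icc (0 : ℝ) 1,
      Tendsto (fun k => ∫ s in (0 : ℝ)..t, b ⌊s * n k⌋₊ * g s) atTop
        (𝓝 (∫ s in (0 : ℝ)..t, B s * g s)))
    (a : ℂ) {P : ℕ → ℕ → 𝔸} (hP0 : ∀ k, P k 0 = 1)
    (hP : ∀ k l, P k (l + 1) = P k l + (a / (n k : ℂ)) • (b l * P k l)) {ε : ℝ} (hε : 0 < ε) :
    ∀ᶠ k in atTop, ∀ t ∈ Set.Icc (0 : ℝ) 1, ‖P k ⌊t * n k⌋₊ - evolution B a t‖ < ε := by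
  have hM0 : 0 ≤ M := (norm_nonneg _).trans (hb 0)
  have h01 : (0 : ℝ) ∈ Set.Icc (0 : ℝ) 1 := by simp
  have hQ := continuousOn_evolution hB hM hM0 a
  obtain ⟨C, hC⟩ := isCompact_Icc.exists_bound_of_continuousOn hQ
  have hC0 : 0 ≤ C := (norm_nonneg _).trans (hC 0 h01)
  have hbm : ∀ k, StronglyMeasurable fun s : ℝ => b ⌊s * n k⌋₊ := fun k =>
    (StronglyMeasurable.of_discrete (f := b)).comp_measurable
      (Nat.measurable_floor.comp (measurable_id.mul_const _))
  have hbM : ∀ k, ∀ s : ℝ, ‖b ⌊s * n k⌋₊‖ ≤ M := fun k s => hb _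
  -- The error from replacing the coefficient, tested against the limit solution, which does not
  -- depend on `k`. Only here does weak convergence enter.
  set Φ : ℕ → ℝ → 𝔸 := fun k t => (∫ s in (0 : ℝ)..t, b ⌊s * n k⌋₊ * evolution B a s) -
    ∫ s in (0 : ℝ)..t, B s * evolution B a s with hΦ
  -- Chosen so that the Gronwall bound with `η = ‖a‖ * δ` stays below `ε`; `‖a‖ + 1` avoids dividing
  -- by zero at `a = 0`.
  set δ : ℝ := ε / (4 * (‖a‖ + 1) * Real.exp (2 * (‖a‖ * M))) with hδ
  have hδ0 : 0 < δ := by positivity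
  have hunif : ∀ᶠ k in atTop, ∀ t ∈ Set.Icc (0 : ℝ) 1, ‖Φ k t‖ < δ / 2 := by
    refine eventually_forall_norm_lt_of_lipschitz (L := 2 * (M * C)) (by positivity) ?_ ?_
      (by positivity)
    · intro k s hs t ht
      have h1 := norm_integral_mul_sub_le (hbm k) (hbM k) hM0 hQ hC hs ht
      have h2 := norm_integral_mul_sub_le hB hM hM0 hQ hC hs ht
      rw [hΦ]
      simp only
      rw [sub_sub_sub_comm]
      refine (norm_sub_le _ _).trans ?_
      linarith
    · intro t ht
      simpa using (hweak _ hQ t ht).sub_const (∫ s in (0 : ℝ)..t, B s * evolution B a s)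
  have hsmall : ∀ᶠ k in atTop, M * C / (n k : ℝ) < δ / 2 := by
    have h : Tendsto (fun k => M * C / (n k : ℝ)) atTop (𝓝 0) :=
      tendsto_const_nhds.div_atTop (tendsto_natCast_atTop_atTop.comp hn)
    exact h.eventually_lt_const (by positivity)
  filter_upwards [hunif, hsmall] with k hk hk2
  have hN : (0 : ℝ) < n k := by exact_mod_cast hn0 k
  -- The projection extends the solution, known to be continuous only on `[0, 1]`, to a globally
  -- measurable function.
  set D : ℝ → 𝔸 := fun t => P k ⌊t * n k⌋₊ -
    evolution B a (Set.projIcc 0 1 zero_le_one t) with hD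
  have hDeq : ∀ t ∈ Set.Icc (0 : ℝ) 1, D t = P k ⌊t * n k⌋₊ - evolution B a t := fun t ht => by
    rw [hD]
    simp only
    rw [Set.projIcc_of_mem _ ht]
  have hPm : StronglyMeasurable fun s : ℝ => P k ⌊s * n k⌋₊ :=
    (StronglyMeasurable.of_discrete (f := P k)).comp_measurable
      (Nat.measurable_floor.comp (measurable_id.mul_const _))
  have hDm : StronglyMeasurable D := by
    refine hPm.sub ?_
    exact (hQ.comp_continuous (continuous_subtype_val.comp continuous_projIcc)
      fun t => Subtype.coe_prop _).stronglyMeasurable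
  set CP : ℝ := Real.exp (‖a‖ * M) with hCP
  have hPb : ∀ m ≤ n k, ‖P k m‖ ≤ CP := by
    intro m hm
    refine (norm_discrete_le hb (hP0 k) (hP k) m).trans ?_
    rw [hCP, norm_div, Complex.norm_natCast]
    refine Real.exp_le_exp.2 ?_
    have hm' : (m : ℝ) ≤ n k := by exact_mod_cast hm
    calc (m : ℝ) * (‖a‖ / n k * M) ≤ n k * (‖a‖ / n k * M) := by gcongr
      _ = ‖a‖ * M := by field_simp
  have hfl : ∀ t ∈ Set.Icc (0 : ℝ) 1, ⌊t * n k⌋₊ ≤ n k := fun t ht => by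
    have h1 := Nat.floor_le (mul_nonneg ht.1 hN.le)
    have : t * n k ≤ n k := mul_le_of_le_one_left hN.le ht.2
    exact_mod_cast h1.trans this
  have hDb : ∀ t ∈ Set.Icc (0 : ℝ) 1, |‖D t‖| ≤ CP + C := fun t ht => by
    rw [abs_norm, hDeq t ht]
    exact (norm_sub_le _ _).trans (add_le_add (hPb _ (hfl t ht)) (hC t ht))
  have hmain : ∀ t ∈ Set.Icc (0 : ℝ) 1,
      ‖D t‖ ≤ ‖a‖ * δ + ‖a‖ * M * ∫ s in (0 : ℝ)..t, ‖D s‖ := by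
    intro t ht
    -- The discrete solution at `t` is an exact integral up to the grid point `τ ≤ t`. The
    -- difference is thus a Gronwall term, the rounding error between `τ` and `t`, and `Φ k t`; the
    -- last two take `δ / 2` each.
    set τ : ℝ := (⌊t * n k⌋₊ : ℝ) / n k with hτ
    have hτ0 : 0 ≤ τ := by positivity
    have hτt : τ ≤ t := by
      rw [hτ, div_le_iff₀ hN]
      exact Nat.floor_le (mul_nonneg ht.1 hN.le)
    have hτ1 : τ ∈ Set.Icc (0 : ℝ) 1 := ⟨hτ0, hτt.trans ht.2⟩
    have htτ : |τ - t| ≤ 1 / n k := by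
      rw [abs_sub_comm, abs_of_nonneg (sub_nonneg.2 hτt), hτ, le_div_iff₀ hN, sub_mul,
        div_mul_cancel₀ _ hN.ne']
      linarith [Nat.lt_floor_add_one (t * n k)]
    have hstep := integral_floor_mul (fun l => b l * P k l) (hn0 k) ⌊t * n k⌋₊
    have hPsum : P k ⌊t * n k⌋₊ = 1 + a • ∫ s in (0 : ℝ)..τ, b ⌊s * n k⌋₊ * P k ⌊s * n k⌋₊ := by
      rw [hstep.2, discrete_eq_sum (hP0 k) (hP k), div_eq_mul_inv, mul_smul]
      congr 2
      rw [← Complex.coe_smul]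
      push_cast
      rfl
    have iQ : IntervalIntegrable (fun s => b ⌊s * n k⌋₊ * evolution B a s) volume 0 τ :=
      intervalIntegrable_mul_continuousOn (hbm k) (hbM k)
        (hQ.mono (Set.uIcc_subset_Icc h01 hτ1))
    have hDint : ∀ r ∈ Set.Icc (0 : ℝ) 1, IntervalIntegrable (fun s => ‖D s‖) volume 0 r := by
      intro r hr
      rw [intervalIntegrable_iff_integrableOn_Icc_of_le hr.1]
      refine Measure.integrableOn_of_bounded (M := CP + C) (by simp)
        hDm.norm.aestronglyMeasurable ?_
      refine (ae_restrict_iff' measurableSet_Icc).2 (ae_of_all _ fun s hs => ?_)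
      rw [Real.norm_eq_abs]
      exact hDb s ⟨hs.1, hs.2.trans hr.2⟩
    have e1 : P k ⌊t * n k⌋₊ - evolution B a t =
        a • (∫ s in (0 : ℝ)..τ, b ⌊s * n k⌋₊ * D s) +
        a • (((∫ s in (0 : ℝ)..τ, b ⌊s * n k⌋₊ * evolution B a s) -
          ∫ s in (0 : ℝ)..t, b ⌊s * n k⌋₊ * evolution B a s) + Φ k t) := by
      have e2 : ∫ s in (0 : ℝ)..τ, b ⌊s * n k⌋₊ * D s =
          (∫ s in (0 : ℝ)..τ, b ⌊s * n k⌋₊ * P k ⌊s * n k⌋₊) -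
            ∫ s in (0 : ℝ)..τ, b ⌊s * n k⌋₊ * evolution B a s := by
        rw [← intervalIntegral.integral_sub hstep.1 iQ]
        refine intervalIntegral.integral_congr fun s hs => ?_
        rw [hDeq s (Set.uIcc_subset_Icc h01 hτ1 hs), mul_sub]
      rw [e2, hPsum, evolution_eq hB hM hM0 a ht, hΦ]
      simp only [smul_sub, smul_add]
      abel
    have n1 : ‖∫ s in (0 : ℝ)..τ, b ⌊s * n k⌋₊ * D s‖ ≤ M * ∫ s in (0 : ℝ)..t, ‖D s‖ := by
      have h1 : ‖∫ s in (0 : ℝ)..τ, b ⌊s * n k⌋₊ * D s‖ ≤ ∫ s in (0 : ℝ)..τ, M * ‖D s‖ :=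
        intervalIntegral.norm_integral_le_of_norm_le hτ0
          (ae_of_all _ fun s _ => (norm_mul_le _ _).trans (by gcongr; exact hb _))
          ((hDint τ hτ1).const_mul M)
      rw [intervalIntegral.integral_const_mul] at h1
      refine h1.trans (mul_le_mul_of_nonneg_left ?_ hM0)
      exact intervalIntegral.integral_mono_interval le_rfl hτ0 hτt
        (ae_of_all _ fun s => norm_nonneg _) (hDint t ht)
    have n2 := norm_integral_mul_sub_le (hbm k) (hbM k) hM0 hQ hC ht hτ1
    have n3 := hk t ht
    have n4 : M * C * |τ - t| ≤ δ / 2 := by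
      refine (mul_le_mul_of_nonneg_left htτ (by positivity)).trans ?_
      rw [mul_one_div]
      exact hk2.le
    rw [hDeq t ht, e1]
    refine (norm_add_le _ _).trans ?_
    rw [norm_smul, norm_smul]
    have n5 := norm_add_le ((∫ s in (0 : ℝ)..τ, b ⌊s * n k⌋₊ * evolution B a s) -
          ∫ s in (0 : ℝ)..t, b ⌊s * n k⌋₊ * evolution B a s) (Φ k t)
    have n6 := mul_le_mul_of_nonneg_left n1 (norm_nonneg a)
    have n7 := mul_le_mul_of_nonneg_left (n5.trans (add_le_add (n2.trans n4) n3.le)) (norm_nonneg a)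
    rw [add_halves] at n7
    rw [mul_assoc]
    linarith
  have hfin := gronwall_integral hDm.norm.measurable (by positivity) (by positivity) hDb hmain
  intro t ht
  rw [← hDeq t ht]
  refine (hfin t ht).trans_lt ?_
  have e : 2 * (‖a‖ * δ) * Real.exp (2 * (‖a‖ * M)) = ε / 2 * (‖a‖ / (‖a‖ + 1)) := by
    rw [hδ]
    field_simp
    ring
  rw [e]
  have h1 : ‖a‖ / (‖a‖ + 1) ≤ 1 := (div_le_one (by positivity)).2 (by linarith)
  nlinarith

omit [CompleteSpace 𝔸] [NormOneClass 𝔸] in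
/-- Uniqueness for the Volterra equation. -/
lemma eqOn_of_volterra (hB : StronglyMeasurable B) (hM : ∀ t, ‖B t‖ ≤ M) (a : ℂ) {R S : ℝ → 𝔸}
    (hR : ContinuousOn R (Set.Icc 0 1)) (hS : ContinuousOn S (Set.Icc 0 1))
    (hRe : ∀ t ∈ Set.Icc (0 : ℝ) 1, R t = 1 + a • ∫ s in (0 : ℝ)..t, B s * R s)
    (hSe : ∀ t ∈ Set.Icc (0 : ℝ) 1, S t = 1 + a • ∫ s in (0 : ℝ)..t, B s * S s) :
    Set.EqOn R S (Set.Icc 0 1) := by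
  have hM0 : 0 ≤ M := (norm_nonneg _).trans (hM 0)
  have h01 : (0 : ℝ) ∈ Set.Icc (0 : ℝ) 1 := by simp
  set D : ℝ → 𝔸 := fun t => R (Set.projIcc 0 1 zero_le_one t) -
    S (Set.projIcc 0 1 zero_le_one t) with hD
  have hDeq : ∀ t ∈ Set.Icc (0 : ℝ) 1, D t = R t - S t := fun t ht => by
    rw [hD]
    simp only
    rw [Set.projIcc_of_mem _ ht]
  have hDm : StronglyMeasurable D :=
    ((hR.sub hS).comp_continuous (continuous_subtype_val.comp continuous_projIcc)
      fun t => Subtype.coe_prop _).stronglyMeasurable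
  have hDc : ContinuousOn D (Set.Icc 0 1) := (hR.sub hS).congr hDeq
  obtain ⟨C, hC⟩ := isCompact_Icc.exists_bound_of_continuousOn hDc
  have hfin := gronwall_integral (u := fun t => ‖D t‖) (η := 0) (K := ‖a‖ * M) (C := C)
    hDm.norm.measurable (by positivity) le_rfl (fun t ht => by rw [abs_norm]; exact hC t ht) ?_
  · intro t ht
    have h := hfin t ht
    rw [mul_zero, zero_mul, norm_le_zero_iff, hDeq t ht] at h
    exact sub_eq_zero.1 h
  · intro t ht
    have hsub := Set.uIcc_subset_Icc h01 ht
    have e : D t = a • ∫ s in (0 : ℝ)..t, B s * D s := by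
      have e2 : ∫ s in (0 : ℝ)..t, B s * D s =
          (∫ s in (0 : ℝ)..t, B s * R s) - ∫ s in (0 : ℝ)..t, B s * S s := by
        rw [← intervalIntegral.integral_sub
          (intervalIntegrable_mul_continuousOn hB hM (hR.mono hsub))
          (intervalIntegrable_mul_continuousOn hB hM (hS.mono hsub))]
        refine intervalIntegral.integral_congr fun s hs => ?_
        rw [hDeq s (hsub hs), mul_sub]
      rw [e2, hDeq t ht, hRe t ht, hSe t ht, smul_sub]
      abel
    rw [zero_add, e, norm_smul, mul_assoc, ← intervalIntegral.integral_const_mul]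
    refine mul_le_mul_of_nonneg_left ?_ (norm_nonneg a)
    refine intervalIntegral.norm_integral_le_of_norm_le ht.1
      (ae_of_all _ fun s _ => (norm_mul_le _ _).trans (by gcongr; exact hM _)) ?_
    exact ((hDc.mono hsub).norm.const_smul M).intervalIntegrable

/-- The solution of the Volterra equation solves the differential equation almost everywhere. -/
lemma ae_hasDerivAt_evolution (hB : StronglyMeasurable B) (hM : ∀ t, ‖B t‖ ≤ M) (a : ℂ) :
    ∀ᵐ t ∂(volume.restrict (Set.Icc (0 : ℝ) 1)),
      HasDerivAt (evolution B a) (a • (B t * evolution B a t)) t := by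
  have hM0 : 0 ≤ M := (norm_nonneg _).trans (hM 0)
  have hQ := continuousOn_evolution hB hM hM0 a
  have hint : IntervalIntegrable (fun s => B s * evolution B a s) volume 0 1 :=
    intervalIntegrable_mul_continuousOn hB hM (by rwa [Set.uIcc_of_le zero_le_one])
  -- The endpoints are discarded because the derivative is two-sided, while the integral equation
  -- holds only on `[0, 1]`.
  have h0 : ∀ᵐ s : ℝ, s ≠ 0 := by simp [ae_iff, measure_singleton]
  have h1 : ∀ᵐ s : ℝ, s ≠ 1 := by simp [ae_iff, measure_singleton]
  rw [ae_restrict_iff' measurableSet_Icc]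
  filter_upwards [hint.ae_hasDerivAt_integral, h0, h1] with t ht ht0 ht1 hmem
  rw [Set.uIcc_of_le zero_le_one] at ht
  have hd := ((ht hmem 0 (by simp)).const_smul a).const_add (1 : 𝔸)
  refine hd.congr_of_eventuallyEq ?_
  filter_upwards [Ioo_mem_nhds (lt_of_le_of_ne hmem.1 ht0.symm) (lt_of_le_of_ne hmem.2 ht1)]
    with s hs
  exact evolution_eq hB hM hM0 a ⟨hs.1.le, hs.2.le⟩

omit [NormOneClass 𝔸] in
/-- The integrated form of the differential equation. -/
lemma eq_one_add_integral_of_ae_hasDerivAt (hB : StronglyMeasurable B) (hM : ∀ t, ‖B t‖ ≤ M)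
    (a : ℂ) {R : ℝ → 𝔸} (hR : AbsolutelyContinuousOnInterval R 0 1) (hR0 : R 0 = 1)
    (hd : ∀ᵐ t ∂(volume.restrict (Set.Icc (0 : ℝ) 1)), HasDerivAt R (a • (B t * R t)) t) :
    ∀ t ∈ Set.Icc (0 : ℝ) 1, R t = 1 + a • ∫ s in (0 : ℝ)..t, B s * R s := by
  have hM0 : 0 ≤ M := (norm_nonneg _).trans (hM 0)
  have h01 : (0 : ℝ) ∈ Set.Icc (0 : ℝ) 1 := by simp
  have hc : ContinuousOn R (Set.Icc 0 1) := by
    have := hR.continuousOn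
    rwa [Set.uIcc_of_le zero_le_one] at this
  obtain ⟨C, hC⟩ := isCompact_Icc.exists_bound_of_continuousOn hc
  have hint : IntervalIntegrable (fun s => B s * R s) volume 0 1 :=
    intervalIntegrable_mul_continuousOn hB hM (by rwa [Set.uIcc_of_le zero_le_one])
  have hLip : LipschitzOnWith (Real.toNNReal (‖a‖ * (M * C)))
      (fun t => a • ∫ s in (0 : ℝ)..t, B s * R s) (Set.uIcc 0 1) := by
    refine LipschitzOnWith.of_dist_le_mul fun t ht s hs => ?_
    rw [Set.uIcc_of_le zero_le_one] at ht hs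
    have hC0 : 0 ≤ C := (norm_nonneg _).trans (hC 0 h01)
    rw [dist_eq_norm, ← smul_sub, norm_smul, Real.coe_toNNReal _ (by positivity), mul_assoc,
      Real.dist_eq]
    exact mul_le_mul_of_nonneg_left (norm_integral_mul_sub_le hB hM hM0 hc hC hs ht)
      (norm_nonneg a)
  -- The difference of `R` and the integral term is absolutely continuous with derivative zero
  -- almost everywhere, hence constant; its value at `0` is `1`.
  obtain ⟨c, hc'⟩ := (hR.sub hLip.absolutelyContinuousOnInterval).const_of_ae_hasDerivAt_zero (by
    rw [ae_restrict_iff' measurableSet_Icc] at hd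
    filter_upwards [hd, hint.ae_hasDerivAt_integral] with t h1 h2 hmem
    rw [Set.uIcc_of_le zero_le_one] at hmem h2
    have := (h1 hmem).sub ((h2 hmem 0 h01).const_smul a)
    rwa [sub_self] at this)
  rw [Set.uIcc_of_le zero_le_one] at hc'
  have hc0 := hc' 0 h01
  simp only [Pi.sub_apply, hR0, intervalIntegral.integral_same, smul_zero, sub_zero] at hc0
  intro t ht
  have := hc' t ht
  rw [← hc0, Pi.sub_apply, sub_eq_iff_eq_add] at this
  exact this

end VolterraConvergence

/-! ### Cauchy's theorem in the upper half plane -/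

section HalfPlane

/-- By Markov's inequality a superlevel set has finite measure, so it contains no half-line. -/
lemma frequently_lt_of_lintegral_ne_top {v : ℝ → ℝ≥0∞} (hv : ∫⁻ x, v x ≠ ∞)
    (hvm : AEMeasurable v) {ε : ℝ≥0∞} (hε : ε ≠ 0) : ∃ᶠ R in atTop, v R < ε := by
  intro h
  obtain ⟨R₀, hR₀⟩ := eventually_atTop.1 h
  have h1 : volume {x | ε ≤ v x} < ∞ := by
    rcases eq_or_ne ε ∞ with rfl | hε'
    · refine (measure_mono (t := {x | 1 ≤ v x}) fun x hx => ?_).trans_lt ?_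
      · exact (le_top : (1 : ℝ≥0∞) ≤ ∞).trans hx
      · exact (meas_ge_le_lintegral_div hvm one_ne_zero ENNReal.one_ne_top).trans_lt
          (by simpa using hv.lt_top)
    · exact (meas_ge_le_lintegral_div hvm hε hε').trans_lt
        (ENNReal.div_lt_top hv hε)
  have h2 : Set.Ici R₀ ⊆ {x | ε ≤ v x} := fun x hx => not_lt.1 (hR₀ x hx)
  have h3 := measure_mono (μ := volume) h2
  rw [Real.volume_Ici] at h3
  exact h1.not_ge h3

/-- Cauchy's theorem in the upper half plane: the integrals of `G` over horizontal lines agree, if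
they are bounded in `L¹`. -/
lemma integral_eq_integral_add_mul_I {G : ℂ → ℂ} (hc : ContinuousOn G {z | 0 ≤ z.im})
    (hd : DifferentiableOn ℂ G {z | 0 < z.im}) {C : ℝ≥0}
    (hC : ∀ y : ℝ, 0 ≤ y → ∫⁻ x : ℝ, ‖G (x + y * I)‖ₑ ≤ C) {Y : ℝ} (hY : 0 < Y) :
    ∫ x : ℝ, G x = ∫ x : ℝ, G (x + Y * I) := by
  have hline : ∀ y : ℝ, 0 ≤ y → Continuous fun x : ℝ => G (x + y * I) := fun y hy =>
    hc.comp_continuous (by fun_prop) fun x => by simpa using hy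
  have hint : ∀ y : ℝ, 0 ≤ y → Integrable fun x : ℝ => G (x + y * I) := fun y hy =>
    ⟨(hline y hy).aestronglyMeasurable, (hC y hy).trans_lt ENNReal.coe_lt_top⟩
  have hint0 : Integrable fun x : ℝ => G x := by simpa using hint 0 le_rfl
  -- Clamping the height gives a function continuous on the whole plane, so that Tonelli's theorem
  -- applies without measurability problems.
  set G' : ℝ × ℝ → ℂ := fun p => G (p.1 + (max p.2 0 : ℝ) * I) with hG'
  have hG'c : Continuous G' := hc.comp_continuous (by fun_prop) fun p => by simp
  set v : ℝ → ℝ≥0∞ := fun x => ∫⁻ y in Set.Icc 0 Y, ‖G' (x, y)‖ₑ with hv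
  have hvm : Measurable v := hG'c.enorm.measurable.lintegral_prod_right'
  have hvint : ∫⁻ x, v x ≠ ∞ := by
    rw [hv, lintegral_lintegral_swap hG'c.enorm.measurable.aemeasurable]
    refine ne_top_of_le_ne_top (b := ∫⁻ _ in Set.Icc 0 Y, (C : ℝ≥0∞)) (by simp; finiteness) ?_
    refine setLIntegral_mono measurable_const fun y hy => ?_
    simpa [hG', max_eq_left hy.1] using hC y hy.1
  have hvneg : ∫⁻ x, v (-x) ≠ ∞ := by rwa [lintegral_neg_eq_self]
  -- The value `v R` bounds the integral over the vertical side at `R`. Integrability of the sum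
  -- makes both sides of the rectangle small for the same arbitrarily large `R`.
  have hv2 : ∫⁻ x, (v x + v (-x)) ≠ ∞ := by
    rw [lintegral_add_left hvm]
    finiteness
  have hside : ∀ R : ℝ, ‖∫ y in (0 : ℝ)..Y, G (R + y * I)‖ₑ ≤ v R := fun R => by
    rw [intervalIntegral.integral_of_le hY.le]
    refine (enorm_integral_le_lintegral_enorm _).trans ?_
    rw [hv]
    refine (lintegral_mono_set Set.Ioc_subset_Icc_self).trans ?_
    refine setLIntegral_mono (hG'c.comp (by fun_prop)).enorm.measurable fun y hy => ?_
    simp [hG', max_eq_left hy.1]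
  have hrect : ∀ R : ℝ, (∫ x in (-R)..R, G x) - ∫ x in (-R)..R, G (x + Y * I) =
      I • (∫ y in (0 : ℝ)..Y, G ((-R : ℝ) + y * I)) - I • ∫ y in (0 : ℝ)..Y, G (R + y * I) := by
    intro R
    have h := integral_boundary_rect_eq_zero_of_continuousOn_of_differentiableOn G
      ((-R : ℝ) : ℂ) (R + Y * I) (hc.mono fun z hz => ?_) (hd.mono fun z hz => ?_)
    · simp only [ofReal_re, ofReal_im, add_re, mul_re, I_re, mul_zero, I_im, mul_one, sub_zero,
        add_zero, add_im, mul_im, zero_add, ofReal_zero, zero_mul] at h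
      linear_combination h
    · have := hz.2
      simp only [Set.mem_preimage, ofReal_im, add_im, mul_im, ofReal_re, I_im, mul_one, I_re,
        mul_zero, add_zero, zero_add] at this
      rw [Set.uIcc_of_le hY.le] at this
      exact this.1
    · have := hz.2
      simp only [Set.mem_preimage, ofReal_im, add_im, mul_im, ofReal_re, I_im, mul_one, I_re,
        mul_zero, add_zero, zero_add] at this
      rw [min_eq_left hY.le] at this
      exact this.1
  have hlim : Tendsto (fun R : ℝ => ‖(∫ x in (-R)..R, G x) - ∫ x in (-R)..R, G (x + Y * I)‖ₑ) atTop
      (𝓝 ‖(∫ x : ℝ, G x) - ∫ x : ℝ, G (x + Y * I)‖ₑ) :=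
    ((intervalIntegral_tendsto_integral hint0 tendsto_neg_atTop_atBot tendsto_id).sub
      (intervalIntegral_tendsto_integral (hint Y hY.le) tendsto_neg_atTop_atBot tendsto_id)).enorm
  have hle : ∀ ε : ℝ≥0∞, 0 < ε → ‖(∫ x : ℝ, G x) - ∫ x : ℝ, G (x + Y * I)‖ₑ ≤ ε := fun ε hε => by
    refine le_of_tendsto_of_frequently hlim ?_
    refine (frequently_lt_of_lintegral_ne_top hv2 (by fun_prop) hε.ne').mono fun R hR => ?_
    rw [hrect R]
    refine enorm_sub_le.trans ?_
    rw [enorm_smul, enorm_smul, show ‖I‖ₑ = 1 by simp [enorm_eq_nnnorm], one_mul, one_mul, add_comm]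
    exact (add_le_add (hside R) (hside (-R))).trans hR.le
  have h0 := le_of_forall_pos_le_add (a := ‖(∫ x : ℝ, G x) - ∫ x : ℝ, G (x + Y * I)‖ₑ) (b := 0)
    fun ε hε => by simpa using hle ε hε
  rw [nonpos_iff_eq_zero, enorm_eq_zero] at h0
  exact sub_eq_zero.1 h0

/-- The integral over the real line of a function that is holomorphic in the upper half plane
vanishes, if the `L¹` norms over horizontal lines are bounded and tend to `0` at infinity. -/
lemma integral_eq_zero_of_halfPlane {G : ℂ → ℂ} (hc : ContinuousOn G {z | 0 ≤ z.im})
    (hd : DifferentiableOn ℂ G {z | 0 < z.im}) {C : ℝ≥0}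
    (hC : ∀ y : ℝ, 0 ≤ y → ∫⁻ x : ℝ, ‖G (x + y * I)‖ₑ ≤ C)
    (hlim : Tendsto (fun y : ℝ => ∫⁻ x : ℝ, ‖G (x + y * I)‖ₑ) atTop (𝓝 0)) :
    ∫ x : ℝ, G x = 0 := by
  have h : ‖∫ x : ℝ, G x‖ₑ ≤ 0 := by
    refine ge_of_tendsto hlim ?_
    filter_upwards [eventually_gt_atTop 0] with Y hY
    rw [integral_eq_integral_add_mul_I hc hd hC hY]
    exact enorm_integral_le_lintegral_enorm _
  simpa using h

/-- The functions of the Hardy space `H²` that are continuous up to the real line. -/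
structure IsHardyCont (F : ℂ → ℂ) : Prop where
  cont : ContinuousOn F {z | 0 ≤ z.im}
  diff : DifferentiableOn ℂ F {z | 0 < z.im}
  bound : ∃ C : ℝ≥0, ∀ y : ℝ, 0 ≤ y → ∫⁻ x : ℝ, ‖F (x + y * I)‖ₑ ^ 2 ≤ C

lemma tendsto_lintegral_inv_one_add_sq (u v : ℝ) :
    Tendsto (fun y : ℝ => ∫⁻ x : ℝ, ENNReal.ofReal (1 + (x - u) ^ 2 + (y - v) ^ 2)⁻¹) atTop
      (𝓝 0) := by
  have h := tendsto_lintegral_filter_of_dominated_convergence (μ := volume) (l := atTop)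
    (F := fun (y : ℝ) (x : ℝ) => ENNReal.ofReal (1 + (x - u) ^ 2 + (y - v) ^ 2)⁻¹) (f := fun _ => 0)
    (fun x => ENNReal.ofReal (1 + (x - u) ^ 2)⁻¹)
    (Eventually.of_forall fun y => (by fun_prop)) (Eventually.of_forall fun y => ae_of_all _ fun x => ?_)
    ?_ (ae_of_all _ fun x => ?_)
  · simpa using h
  · refine ENNReal.ofReal_le_ofReal ?_
    exact inv_anti₀ (by positivity) (by nlinarith [sq_nonneg (y - v)])
  · have hi : Integrable fun x : ℝ => (1 + (x - u) ^ 2)⁻¹ :=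
      integrable_inv_one_add_sq.comp_sub_right u
    exact hi.lintegral_lt_top.ne
  · have h1 : Tendsto (fun y : ℝ => 1 + (x - u) ^ 2 + (y - v) ^ 2) atTop atTop := by
      refine tendsto_atTop_add_const_left _ _ ?_
      exact (tendsto_pow_atTop two_ne_zero).comp (tendsto_atTop_add_const_right _ _ tendsto_id)
    simpa using ENNReal.tendsto_ofReal h1.inv_tendsto_atTop

lemma lintegral_inv_one_add_sq_le (u v y : ℝ) :
    ∫⁻ x : ℝ, ENNReal.ofReal (1 + (x - u) ^ 2 + (y - v) ^ 2)⁻¹ ≤ ENNReal.ofReal Real.pi := by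
  have hi : Integrable fun x : ℝ => (1 + (x - u) ^ 2)⁻¹ :=
    integrable_inv_one_add_sq.comp_sub_right u
  have h1 : ∫⁻ x : ℝ, ENNReal.ofReal (1 + (x - u) ^ 2)⁻¹ = ENNReal.ofReal Real.pi := by
    rw [← ofReal_integral_eq_lintegral_ofReal hi (ae_of_all _ fun x => by positivity),
      integral_sub_right_eq_self (fun x : ℝ => (1 + x ^ 2)⁻¹) u, integral_univ_inv_one_add_sq]
  rw [← h1]
  refine lintegral_mono fun x => ENNReal.ofReal_le_ofReal ?_
  exact inv_anti₀ (by positivity) (by nlinarith [sq_nonneg (y - v)])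

/-- A continuous function on the closed half plane is bounded near `a`. -/
lemma exists_bound_near {h : ℂ → ℂ} (hc : ContinuousOn h {z | 0 ≤ z.im}) (a : ℂ) :
    ∃ C : ℝ, 0 ≤ C ∧ ∀ z : ℂ, 0 ≤ z.im → ‖z - a‖ ≤ 1 → ‖h z‖ ≤ C := by
  have hK : IsCompact (Metric.closedBall a 1 ∩ {z : ℂ | 0 ≤ z.im}) :=
    (isCompact_closedBall a 1).inter_right (isClosed_le continuous_const continuous_im)
  obtain ⟨C, hC⟩ := hK.exists_bound_of_continuousOn (hc.mono Set.inter_subset_right)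
  exact ⟨max C 0, le_max_right _ _, fun z hz hza =>
    (hC z ⟨by simpa [dist_eq_norm] using hza, hz⟩).trans (le_max_left _ _)⟩

/-- `1 + |z - a|²` on a horizontal line. -/
lemma norm_sub_sq_line (a : ℂ) (x y : ℝ) :
    ‖(x + y * I : ℂ) - a‖ ^ 2 = (x - a.re) ^ 2 + (y - a.im) ^ 2 := by
  rw [← normSq_eq_norm_sq, normSq_apply]
  simp
  ring

/-- If `φ = (z - a) G` is in the Hardy space and `G` is holomorphic, then
`∫ φ(x) / (x - a) dx = 0`. -/
lemma IsHardyCont.integral_div_sub_eq_zero {φ G : ℂ → ℂ} (hφ : IsHardyCont φ) {a : ℂ}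
    (hc : ContinuousOn G {z | 0 ≤ z.im}) (hd : DifferentiableOn ℂ G {z | 0 < z.im})
    (hG : ∀ z, 0 ≤ z.im → (z - a) * G z = φ z) :
    Integrable (fun x : ℝ => φ x / (x - a)) ∧ ∫ x : ℝ, φ x / (x - a) = 0 := by
  obtain ⟨C, hC⟩ := hφ.bound
  obtain ⟨C₁, hC₁0, hC₁⟩ := exists_bound_near hc a
  -- the pointwise bound by the inequality of arithmetic and geometric means
  have hpt : ∀ δ : ℝ, 0 < δ → ∀ x y : ℝ, 0 ≤ y → ‖G (x + y * I)‖ₑ ≤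
      ENNReal.ofReal δ * ‖φ (x + y * I)‖ₑ ^ 2 + ENNReal.ofReal (2 * C₁ + 2 / δ) *
        ENNReal.ofReal (1 + (x - a.re) ^ 2 + (y - a.im) ^ 2)⁻¹ := by
    intro δ hδ x y hy
    set z : ℂ := x + y * I with hz
    have hzim : 0 ≤ z.im := by simpa [hz] using hy
    have hk := norm_sub_sq_line a x y
    rw [← hz] at hk
    rw [add_assoc, ← hk, ← ofReal_norm, ← ofReal_norm,
      ← ENNReal.ofReal_pow (norm_nonneg _), ← ENNReal.ofReal_mul hδ.le,
      ← ENNReal.ofReal_mul (by positivity), ← ENNReal.ofReal_add (by positivity) (by positivity)]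
    refine ENNReal.ofReal_le_ofReal ?_
    rcases le_or_gt ‖z - a‖ 1 with h1 | h1
    · have h2 := hC₁ z hzim h1
      have h3 : (1 : ℝ) / 2 ≤ (1 + ‖z - a‖ ^ 2)⁻¹ := by
        rw [one_div]
        gcongr
        nlinarith [norm_nonneg (z - a)]
      have h4 : C₁ ≤ (2 * C₁ + 2 / δ) * (1 + ‖z - a‖ ^ 2)⁻¹ := by
        have h5 : 0 ≤ 2 / δ := by positivity
        nlinarith
      have h6 : 0 ≤ δ * ‖φ z‖ ^ 2 := by positivity
      linarith
    · have h2 : ‖z - a‖ * ‖G z‖ = ‖φ z‖ := by rw [← norm_mul, hG z hzim]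
      set r := ‖z - a‖
      set g := ‖G z‖
      have hg : 0 ≤ g := norm_nonneg _
      have h3 : 1 / (2 * r ^ 2) ≤ (1 + r ^ 2)⁻¹ := by
        rw [one_div]
        gcongr
        nlinarith
      have h5 : g ≤ δ * (r * g) ^ 2 + 2 / δ * (1 / (2 * r ^ 2)) := by
        have h6 : 2 / δ * (1 / (2 * r ^ 2)) = 1 / (δ * r ^ 2) := by field_simp
        rw [h6]
        have h7 : 0 < δ * r ^ 2 := by positivity
        have h8 : δ * (r * g) ^ 2 + 1 / (δ * r ^ 2) - g =
            ((δ * r ^ 2 * g - 1 / 2) ^ 2 + 3 / 4) / (δ * r ^ 2) := by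
          field_simp
          ring
        have h9 : 0 ≤ ((δ * r ^ 2 * g - 1 / 2) ^ 2 + 3 / 4) / (δ * r ^ 2) := by positivity
        linarith
      rw [← h2]
      refine h5.trans ?_
      have h10 : 2 / δ * (1 / (2 * r ^ 2)) ≤ (2 * C₁ + 2 / δ) * (1 + r ^ 2)⁻¹ := by
        gcongr
        linarith
      linarith
  have hline : ∀ y : ℝ, 0 ≤ y → Measurable fun x : ℝ => ‖φ (x + y * I)‖ₑ ^ 2 := fun y hy =>
    ((hφ.cont.comp_continuous (by fun_prop) fun x => by simpa using hy :
      Continuous fun x : ℝ => φ (x + y * I)).enorm.measurable).pow_const 2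
  have hL1 : ∀ δ : ℝ, 0 < δ → ∀ y : ℝ, 0 ≤ y → ∫⁻ x : ℝ, ‖G (x + y * I)‖ₑ ≤
      ENNReal.ofReal δ * C + ENNReal.ofReal (2 * C₁ + 2 / δ) *
        ∫⁻ x : ℝ, ENNReal.ofReal (1 + (x - a.re) ^ 2 + (y - a.im) ^ 2)⁻¹ := by
    intro δ hδ y hy
    refine (lintegral_mono fun x => hpt δ hδ x y hy).trans ?_
    rw [lintegral_add_left ((hline y hy).const_mul _), lintegral_const_mul _ (hline y hy),
      lintegral_const_mul _ (by fun_prop)]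
    gcongr
    exact hC y hy
  have hbd : ∀ y : ℝ, 0 ≤ y → ∫⁻ x : ℝ, ‖G (x + y * I)‖ₑ ≤
      ((C + Real.toNNReal (2 * C₁ + 2) * Real.toNNReal Real.pi : ℝ≥0) : ℝ≥0∞) := by
    intro y hy
    refine (hL1 1 one_pos y hy).trans ?_
    push_cast
    rw [ENNReal.ofReal_one, one_mul, div_one]
    gcongr
    exacts [le_rfl, lintegral_inv_one_add_sq_le _ _ _]
  -- The `L²` norms of `φ` are bounded but need not tend to `0`. The free weight `δ` is fixed first
  -- to make their share small; then the kernel term tends to `0` as `y → ∞`.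
  have hlim : Tendsto (fun y : ℝ => ∫⁻ x : ℝ, ‖G (x + y * I)‖ₑ) atTop (𝓝 0) := by
    rw [ENNReal.tendsto_nhds_zero]
    intro ε hε
    rcases eq_or_ne ε ∞ with rfl | hεt
    · exact Eventually.of_forall fun _ => le_top
    obtain ⟨δ, hδ0, hδ⟩ : ∃ δ : ℝ, 0 < δ ∧ ENNReal.ofReal δ * C ≤ ε / 2 := by
      have he : 0 < (ε / 2).toReal := ENNReal.toReal_pos (by simpa using hε.ne') (by finiteness)
      refine ⟨(ε / 2).toReal / (C + 1), by positivity, ?_⟩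
      rw [← ENNReal.ofReal_coe_nnreal, ← ENNReal.ofReal_mul (by positivity)]
      refine ENNReal.ofReal_le_of_le_toReal ?_
      rw [div_mul_eq_mul_div, div_le_iff₀ (by positivity)]
      gcongr
      linarith
    have h1 := ENNReal.Tendsto.const_mul (a := ENNReal.ofReal (2 * C₁ + 2 / δ))
      (tendsto_lintegral_inv_one_add_sq a.re a.im) (Or.inr ENNReal.ofReal_ne_top)
    rw [mul_zero, ENNReal.tendsto_nhds_zero] at h1
    filter_upwards [h1 (ε / 2) (by simpa using hε.ne'), eventually_ge_atTop 0] with y hy hy0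
    refine (hL1 δ hδ0 y hy0).trans ?_
    rw [← ENNReal.add_halves ε]
    exact add_le_add hδ hy
  have hGint : Integrable fun x : ℝ => G x := by
    refine ⟨(hc.comp_continuous continuous_ofReal fun x => by simp).aestronglyMeasurable, ?_⟩
    have := hbd 0 le_rfl
    simp only [ofReal_zero, zero_mul, add_zero] at this
    exact this.trans_lt ENNReal.coe_lt_top
  have hae : (fun x : ℝ => G x) =ᵐ[volume] fun x : ℝ => φ x / (x - a) := by
    have h0 : ∀ᵐ x : ℝ, x ≠ a.re := by simp [ae_iff, measure_singleton]
    filter_upwards [h0] with x hx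
    have hne : (x : ℂ) - a ≠ 0 := fun h => hx (by simpa [sub_eq_zero] using congrArg re h)
    rw [← hG x (by simp), mul_div_cancel_left₀ _ hne]
  refine ⟨hGint.congr hae, ?_⟩
  rw [← integral_congr_ae hae]
  exact integral_eq_zero_of_halfPlane hc hd hbd hlim

end HalfPlane

/-! ### Cauchy integrals of Hardy functions continuous up to the real line -/

section HardyCont

lemma line_im (x y : ℝ) : ((x : ℂ) + (y : ℂ) * I).im = y := by simp

/-- The bound on the lines `y > 0` passes to the real line by Fatou's lemma along `y + 1 / (n + 1)`.
-/
lemma MemHardyTwo.isHardyCont {F : ℂ → ℂ} (hF : MemHardyTwo F)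
    (hc : ContinuousOn F {z | 0 ≤ z.im}) : IsHardyCont F := by
  obtain ⟨hd, C, hC⟩ := hF
  refine ⟨hc, hd, C, fun y hy => ?_⟩
  set F' : ℝ → ℝ → ℝ≥0∞ := fun y x => ‖F (x + y * I)‖ₑ ^ 2 with hF'
  have hm : ∀ n : ℕ, Measurable (F' (y + 1 / (n + 1))) := fun n =>
    ((hc.comp_continuous (by fun_prop) fun x => by
      rw [Set.mem_ofPred_eq, line_im]
      positivity : Continuous fun x : ℝ =>
        F (x + (y + 1 / (n + 1) : ℝ) * I)).enorm.measurable).pow_const 2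
  have hlim : ∀ x, Tendsto (fun n : ℕ => F' (y + 1 / (n + 1)) x) atTop (𝓝 (F' y x)) := by
    intro x
    have h1 : Tendsto (fun n : ℕ => (x : ℂ) + ((y + 1 / ((n : ℝ) + 1) : ℝ) : ℂ) * I) atTop
        (𝓝[{z | 0 ≤ z.im}] (x + y * I)) := by
      refine tendsto_nhdsWithin_iff.2 ⟨?_, Eventually.of_forall fun n => ?_⟩
      · have h2 : Tendsto (fun n : ℕ => y + 1 / ((n : ℝ) + 1)) atTop (𝓝 y) := by
          simpa using tendsto_one_div_add_atTop_nhds_zero_nat.const_add y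
        exact ((continuous_ofReal.tendsto y).comp h2).mul_const I |>.const_add _
      · rw [Set.mem_ofPred_eq, line_im]
        positivity
    exact ((ENNReal.continuous_pow 2).tendsto _).comp
      ((hc (x + y * I) (by simpa using hy)).tendsto.comp h1).enorm
  have hF := lintegral_liminf_le (μ := volume) (u := atTop) hm
  have he : (fun x => liminf (fun n : ℕ => F' (y + 1 / (n + 1)) x) atTop) = F' y := by
    funext x
    exact (hlim x).liminf_eq
  rw [he] at hF
  refine hF.trans ?_
  refine liminf_le_of_le (by isBoundedDefault) fun b hb => ?_
  obtain ⟨n, hn⟩ := hb.exists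
  exact hn.trans (hC _ (by positivity))

/-- Compactness bounds `h` near `a`, and the hypothesis gives decay away from `a`. Together `|h|²`
is at most a constant times `1 / (1 + |z - a|²)`, whose integrals over horizontal lines are at most
`π`. -/
lemma isHardyCont_of_norm_sub_mul_le {h : ℂ → ℂ} (hc : ContinuousOn h {z | 0 ≤ z.im})
    (hd : DifferentiableOn ℂ h {z | 0 < z.im}) {a : ℂ} {c : ℝ}
    (hb : ∀ z, 0 ≤ z.im → ‖z - a‖ * ‖h z‖ ≤ c) : IsHardyCont h := by
  obtain ⟨C₁, hC₁0, hC₁⟩ := exists_bound_near hc a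
  refine ⟨hc, hd, Real.toNNReal (2 * C₁ ^ 2 + 2 * c ^ 2) * Real.toNNReal Real.pi, fun y hy => ?_⟩
  push_cast
  refine le_trans ?_ (mul_le_mul_right (lintegral_inv_one_add_sq_le a.re a.im y) _)
  rw [← lintegral_const_mul _ (by fun_prop)]
  refine lintegral_mono fun x => ?_
  set z : ℂ := x + y * I with hz
  have hzim : 0 ≤ z.im := by simpa [hz] using hy
  have hk := norm_sub_sq_line a x y
  rw [← hz] at hk
  rw [add_assoc, ← hk, ← ofReal_norm, ← ENNReal.ofReal_pow (norm_nonneg _), ENNReal.ofNNReal_toNNReal,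
    ← ENNReal.ofReal_mul (by positivity)]
  refine ENNReal.ofReal_le_ofReal ?_
  rw [← div_eq_mul_inv, le_div_iff₀ (by positivity)]
  have h2 := hb z hzim
  have hr := norm_nonneg (z - a)
  have hg := norm_nonneg (h z)
  rcases le_or_gt ‖z - a‖ 1 with h1 | h1
  · have h3 := hC₁ z hzim h1
    have h4 : ‖h z‖ ^ 2 ≤ C₁ ^ 2 := by gcongr
    have h5 : ‖z - a‖ ^ 2 ≤ 1 := by nlinarith
    nlinarith [sq_nonneg c, sq_nonneg ‖h z‖]
  · have h4 : (‖z - a‖ * ‖h z‖) ^ 2 ≤ c ^ 2 := by gcongr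
    have h5 : ‖h z‖ ^ 2 ≤ (‖z - a‖ * ‖h z‖) ^ 2 := by
      rw [mul_pow]
      exact le_mul_of_one_le_left (sq_nonneg _) (one_le_pow₀ h1.le)
    nlinarith [sq_nonneg C₁]

lemma IsHardyCont.memHardyTwo {F : ℂ → ℂ} (hF : IsHardyCont F) : MemHardyTwo F :=
  ⟨hF.diff, hF.bound.choose, fun y hy => hF.bound.choose_spec y hy.le⟩

lemma IsHardyCont.sub_const_mul {F G : ℂ → ℂ} (hF : IsHardyCont F) (hG : IsHardyCont G) (c : ℂ) :
    IsHardyCont fun z => F z - c * G z := by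
  obtain ⟨C₁, h₁⟩ := hF.bound
  obtain ⟨C₂, h₂⟩ := hG.bound
  refine ⟨hF.cont.sub (continuousOn_const.mul hG.cont),
    hF.diff.sub (hG.diff.const_mul c), 2 * C₁ + 2 * ‖c‖₊ ^ 2 * C₂, fun y hy => ?_⟩
  have hmeas : ∀ H : ℂ → ℂ, ContinuousOn H {z | 0 ≤ z.im} →
      Measurable fun x : ℝ => ‖H (x + y * I)‖ₑ ^ 2 := fun H hH =>
    ((hH.comp_continuous (by fun_prop) fun x => by simpa using hy :
      Continuous fun x : ℝ => H (x + y * I)).enorm.measurable).pow_const 2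
  calc ∫⁻ x : ℝ, ‖F (x + y * I) - c * G (x + y * I)‖ₑ ^ 2
      ≤ ∫⁻ x : ℝ, (2 * ‖F (x + y * I)‖ₑ ^ 2 + 2 * ‖c‖ₑ ^ 2 * ‖G (x + y * I)‖ₑ ^ 2) := by
        refine lintegral_mono fun x => ?_
        have h : ‖F (x + y * I) - c * G (x + y * I)‖₊ ^ 2 ≤
            2 * ‖F (x + y * I)‖₊ ^ 2 + 2 * ‖c‖₊ ^ 2 * ‖G (x + y * I)‖₊ ^ 2 := by
          have h1 := nnnorm_sub_le (F (x + y * I)) (c * G (x + y * I))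
          rw [nnnorm_mul] at h1
          have h2 : ‖F (x + y * I) - c * G (x + y * I)‖₊ ^ 2 ≤
            (‖F (x + y * I)‖₊ + ‖c‖₊ * ‖G (x + y * I)‖₊) ^ 2 := by gcongr
          refine h2.trans ?_
          rw [← NNReal.coe_le_coe]
          push_cast
          nlinarith [sq_nonneg (‖F (x + y * I)‖ - ‖c‖ * ‖G (x + y * I)‖)]
        simp only [enorm_eq_nnnorm]
        exact_mod_cast h
    _ ≤ _ := by
        rw [lintegral_add_left ((hmeas F hF.cont).const_mul _),
          lintegral_const_mul _ (hmeas F hF.cont), lintegral_const_mul _ (hmeas G hG.cont)]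
        push_cast
        gcongr
        exacts [h₁ y hy, le_rfl, h₂ y hy]

/-- Cauchy's theorem for `F(x) / (x - a)`, `a` below the real line. -/
lemma IsHardyCont.integral_div_sub_of_im_neg {F : ℂ → ℂ} (hF : IsHardyCont F) {a : ℂ}
    (ha : a.im < 0) :
    Integrable (fun x : ℝ => F x / (x - a)) ∧ ∫ x : ℝ, F x / (x - a) = 0 := by
  have hne : ∀ z : ℂ, 0 ≤ z.im → z - a ≠ 0 := fun z hz h => by
    rw [sub_eq_zero] at h
    rw [h] at hz
    exact absurd hz (not_le.2 ha)
  refine hF.integral_div_sub_eq_zero (G := fun z => F z / (z - a)) ?_ ?_ ?_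
  · exact hF.cont.div (by fun_prop) fun z hz => hne z hz
  · exact hF.diff.div (by fun_prop) fun z hz => hne z (le_of_lt hz)
  · exact fun z hz => mul_div_cancel₀ _ (hne z hz)

/-- Cauchy's theorem for `φ(x) / (x - a)` in the case `φ(a) = 0`. -/
lemma IsHardyCont.integral_div_sub_of_eq_zero {φ : ℂ → ℂ} (hφ : IsHardyCont φ) {a : ℂ}
    (hd : DifferentiableAt ℂ φ a) (h0 : φ a = 0) :
    Integrable (fun x : ℝ => φ x / (x - a)) ∧ ∫ x : ℝ, φ x / (x - a) = 0 := by
  refine hφ.integral_div_sub_eq_zero (G := dslope φ a) ?_ ?_ ?_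
  · intro z hz
    rcases eq_or_ne z a with rfl | hza
    · exact (continuousAt_dslope_same.2 hd).continuousWithinAt
    · exact (continuousWithinAt_dslope_of_ne hza).2 (hφ.cont z hz)
  · rcases lt_or_ge 0 a.im with ha | ha
    · exact (differentiableOn_dslope ((isOpen_lt continuous_const continuous_im).mem_nhds ha)).2
        hφ.diff
    · exact (differentiableOn_dslope_of_notMem (s := {z : ℂ | 0 < z.im}) (not_lt.2 ha)).2 hφ.diff
  · intro z _
    have := sub_smul_dslope φ a z
    rwa [h0, sub_zero, smul_eq_mul] at this

/-- Comparison functions: with `c = a - ζ` the value at `a` is `1`, so subtracting `F a` times this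
function from `F` creates a zero at `a` within the Hardy space. -/
lemma isHardyCont_cauchy {ζ : ℂ} (hζ : ζ.im < 0) (c : ℂ) : IsHardyCont fun z => c / (z - ζ) := by
  have hne : ∀ z : ℂ, 0 ≤ z.im → z - ζ ≠ 0 := fun z hz h => by
    rw [sub_eq_zero] at h
    rw [h] at hz
    exact absurd hz (not_le.2 hζ)
  refine isHardyCont_of_norm_sub_mul_le (a := ζ) (c := ‖c‖) ?_ ?_ ?_
  · exact continuousOn_const.div (by fun_prop) fun z hz => hne z hz
  · exact (differentiableOn_const c).div (by fun_prop) fun z hz => hne z (le_of_lt hz)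
  · intro z hz
    rw [← norm_mul, mul_div_cancel₀ _ (hne z hz)]

/-- The Poisson integral of a constant. -/
lemma integral_poisson (u : ℝ) {v : ℝ} (hv : 0 < v) :
    Integrable (fun x : ℝ => (v / ((x - u) ^ 2 + v ^ 2) : ℝ)) ∧
      ∫ x : ℝ, v / ((x - u) ^ 2 + v ^ 2) = Real.pi := by
  have he : ∀ x : ℝ, v / ((x - u) ^ 2 + v ^ 2) = v⁻¹ * (1 + (v⁻¹ * (x - u)) ^ 2)⁻¹ := by
    intro x
    have : 0 < (x - u) ^ 2 + v ^ 2 := by positivity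
    field_simp
    ring
  simp_rw [he]
  refine ⟨((integrable_inv_one_add_sq.comp_mul_left' (inv_ne_zero hv.ne')).comp_sub_right
    u).const_mul _, ?_⟩
  rw [integral_const_mul, integral_sub_right_eq_self (fun x : ℝ => (1 + (v⁻¹ * x) ^ 2)⁻¹) u,
    Measure.integral_comp_mul_left (fun x : ℝ => (1 + x ^ 2)⁻¹) v⁻¹, integral_univ_inv_one_add_sq]
  rw [inv_inv, abs_of_pos hv, smul_eq_mul, inv_mul_cancel_left₀ hv.ne']

/-- Cauchy's formula in the Hardy space of the upper half plane. -/
lemma IsHardyCont.integral_div_sub_of_im_pos {F : ℂ → ℂ} (hF : IsHardyCont F) {a : ℂ}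
    (ha : 0 < a.im) :
    Integrable (fun x : ℝ => F x / (x - a)) ∧
      ∫ x : ℝ, F x / (x - a) = 2 * Real.pi * I * F a := by
  have hc : (conj a).im < 0 := by simpa using ha
  have hne : a - conj a ≠ 0 := fun h => by
    have := congrArg im h
    simp at this
    linarith
  -- The part `F - F a * κ` vanishes at `a` and contributes nothing. What remains, `κ x / (x - a)`,
  -- is `2i` times the Poisson kernel, which has integral `π`.
  set κ : ℂ → ℂ := fun z => (a - conj a) / (z - conj a) with hκ
  have hκa : κ a = 1 := div_self hne
  have hφ := hF.sub_const_mul (isHardyCont_cauchy hc (a - conj a)) (F a)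
  have hnhds : {z : ℂ | 0 < z.im} ∈ 𝓝 a :=
    (isOpen_lt continuous_const continuous_im).mem_nhds ha
  obtain ⟨i1, e1⟩ := hφ.integral_div_sub_of_eq_zero (a := a) (hφ.diff.differentiableAt hnhds)
    (by
      change F a - F a * κ a = 0
      rw [hκa, mul_one, sub_self])
  obtain ⟨i2, e2⟩ := integral_poisson a.re ha
  have hx : ∀ x : ℝ, F x / (x - a) = (F x - F a * ((a - conj a) / (x - conj a))) / (x - a) +
      2 * I * F a * ((a.im / ((x - a.re) ^ 2 + a.im ^ 2) : ℝ) : ℂ) := by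
    intro x
    have h1 : (x : ℂ) - a ≠ 0 := fun h => by
      have := congrArg im h
      simp at this
      linarith
    have h2 : (x : ℂ) - conj a ≠ 0 := fun h => by
      have := congrArg im h
      simp at this
      linarith
    have h3 : (((x - a.re) ^ 2 + a.im ^ 2 : ℝ) : ℂ) = (x - a) * (x - conj a) := by
      rw [show (x : ℂ) - conj a = conj (x - a) by simp, mul_conj, normSq_apply]
      congr 1
      simp
      ring
    have h4 : a - conj a = 2 * I * a.im := by
      apply Complex.ext <;> simp
      ring
    rw [ofReal_div, h3, h4]
    field_simp
    ring
  simp_rw [hx]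
  have i2' : Integrable fun x : ℝ =>
      2 * I * F a * ((a.im / ((x - a.re) ^ 2 + a.im ^ 2) : ℝ) : ℂ) :=
    (i2.ofReal (𝕜 := ℂ)).const_mul (2 * I * F a)
  refine ⟨i1.add i2', ?_⟩
  rw [integral_add i1 i2', e1, integral_const_mul, integral_complex_ofReal, e2]
  ring

/-- Conjugate form of integrability and vanishing of integrals. -/
lemma integral_conj_eq_zero {g : ℝ → ℂ} (h : Integrable g ∧ ∫ x, g x = 0) :
    Integrable (fun x => conj (g x)) ∧ ∫ x, conj (g x) = 0 := by
  refine ⟨conjCLE.toContinuousLinearMap.integrable_comp h.1, ?_⟩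
  rw [integral_conj, h.2, map_zero]

/-- The combination of Cauchy integrals that appears in de Branges spaces, for `a` in the closed
upper half plane. -/
lemma IsHardyCont.integral_combination {F₁ F₂ : ℂ → ℂ} (h₁ : IsHardyCont F₁)
    (h₂ : IsHardyCont F₂) {a c₁ c₂ w : ℂ} (ha : 0 ≤ a.im) (hd₁ : DifferentiableAt ℂ F₁ a)
    (hd₂ : a.im = 0 → DifferentiableAt ℂ F₂ a) (hw₁ : c₁ * F₁ a = w)
    (hw₂ : a.im = 0 → c₂ * conj (F₂ a) = w) :
    Integrable (fun x : ℝ => (c₁ * F₁ x - c₂ * conj (F₂ x)) / (x - a)) ∧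
      ∫ x : ℝ, (c₁ * F₁ x - c₂ * conj (F₂ x)) / (x - a) = 2 * Real.pi * I * w := by
  rcases ha.eq_or_lt with ha0 | ha0
  · have hac : conj a = a := conj_eq_iff_im.2 ha0.symm
    have hζ : (a - I).im < 0 := by simp [← ha0]
    -- For real `a` the two fractions are singular on the line of integration, but both have the
    -- same coefficient `w` there, so the singularities cancel. After subtracting multiples of `κ`,
    -- the remainder `w (κ - conj κ) / (x - a)` is `2i w` times the Poisson kernel of height `1`.
    set κ : ℂ → ℂ := fun z => I / (z - (a - I)) with hκ
    have hκd : DifferentiableAt ℂ κ a := by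
      refine (differentiableAt_const I).div (by fun_prop) ?_
      simp
    have hκa : κ a = 1 := by simp [hκ]
    have hz : ∀ F : ℂ → ℂ, IsHardyCont F → DifferentiableAt ℂ F a →
        Integrable (fun x : ℝ => (F x - F a * κ x) / (x - a)) ∧
          ∫ x : ℝ, (F x - F a * κ x) / (x - a) = 0 := fun F hF hdF =>
      (hF.sub_const_mul (isHardyCont_cauchy hζ I) (F a)).integral_div_sub_of_eq_zero
        (hdF.sub (hκd.const_mul (F a))) (by
          change F a - F a * κ a = 0
          rw [hκa, mul_one, sub_self])
    obtain ⟨i1, e1⟩ := hz F₁ h₁ hd₁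
    obtain ⟨i2, e2⟩ := integral_conj_eq_zero (hz F₂ h₂ (hd₂ ha0.symm))
    obtain ⟨i3, e3⟩ := integral_poisson a.re one_pos
    have i1' := i1.const_mul c₁
    have i2' := i2.const_mul c₂
    have i3' : Integrable fun x : ℝ =>
        2 * I * w * ((1 / ((x - a.re) ^ 2 + 1 ^ 2) : ℝ) : ℂ) :=
      (i3.ofReal (𝕜 := ℂ)).const_mul (2 * I * w)
    have hx : (fun x : ℝ => (c₁ * F₁ x - c₂ * conj (F₂ x)) / (x - a)) =ᵐ[volume] fun x : ℝ =>
        c₁ * ((F₁ x - F₁ a * κ x) / (x - a)) - c₂ * conj ((F₂ x - F₂ a * κ x) / (x - a)) +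
          2 * I * w * ((1 / ((x - a.re) ^ 2 + 1 ^ 2) : ℝ) : ℂ) := by
      have h0 : ∀ᵐ x : ℝ, x ≠ a.re := by simp [ae_iff, measure_singleton]
      filter_upwards [h0] with x hx
      have hre : a = a.re := (conj_eq_iff_re.1 hac).symm
      have h1 : (x : ℂ) - a ≠ 0 := fun h => hx (by simpa [sub_eq_zero] using congrArg re h)
      have h2 : (x : ℂ) - (a - I) ≠ 0 := fun h => by
        have := congrArg im h
        simp [← ha0] at this
      have h3 : (x : ℂ) - (a + I) ≠ 0 := fun h => by
        have := congrArg im h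
        simp [← ha0] at this
      have h4 : (((x - a.re) ^ 2 + 1 ^ 2 : ℝ) : ℂ) = (x - (a - I)) * (x - (a + I)) := by
        push_cast
        rw [← hre]
        linear_combination I_sq
      have h5 : conj (κ x) = -I / (x - (a + I)) := by
        simp [hκ, hac]
      have hw₂' := hw₂ ha0.symm
      rw [map_div₀, map_sub, map_mul, map_sub, conj_ofReal, hac, h5, ofReal_div, h4, ofReal_one]
      have h6 : 2 * I * w * (1 / ((x - (a - I)) * (x - (a + I)))) =
          w * (I / (x - (a - I)) - -I / (x - (a + I))) / (x - a) := by
        field_simp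
        ring
      have h7 : w * (I / (x - (a - I)) - -I / (x - (a + I))) =
          c₁ * F₁ a * (I / (x - (a - I))) - c₂ * conj (F₂ a) * (-I / (x - (a + I))) := by
        rw [hw₁, hw₂']
        ring
      rw [h6, h7, hκ]
      ring
    refine ⟨((i1'.sub i2').add i3').congr hx.symm, ?_⟩
    rw [integral_congr_ae hx, integral_add (by exact i1'.sub i2') i3', integral_sub i1' i2',
      integral_const_mul, integral_const_mul, integral_const_mul, e1, e2, integral_complex_ofReal, e3]
    ring
  -- For `Im a > 0` the second term is the conjugate of a Cauchy integral at `conj a`, below the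
  -- line, and vanishes; only `F₁` contributes.
  · have hc : (conj a).im < 0 := by simpa using ha0
    obtain ⟨i1, e1⟩ := h₁.integral_div_sub_of_im_pos ha0
    obtain ⟨i2, e2⟩ := integral_conj_eq_zero (h₂.integral_div_sub_of_im_neg hc)
    have i1' := i1.const_mul c₁
    have i2' := i2.const_mul c₂
    have hx : ∀ x : ℝ, (c₁ * F₁ x - c₂ * conj (F₂ x)) / (x - a) =
        c₁ * (F₁ x / (x - a)) - c₂ * conj (F₂ x / (x - conj a)) := by
      intro x
      rw [map_div₀, map_sub, conj_ofReal, conj_conj]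
      ring
    simp_rw [hx]
    refine ⟨i1'.sub i2', ?_⟩
    rw [integral_sub i1' i2', integral_const_mul, integral_const_mul, e1, e2, ← hw₁]
    ring

end HardyCont

/-! ### The reproducing kernel of a de Branges space -/

section DeBranges

/-- A pair of real entire functions without common zeros, for which `A + i B` is a Hermite-Biehler
function, together with its kernel `K(a, b) = (A(a) B(b) - B(a) A(b)) / (a - b)`. -/
structure IsKernelPair (A B : ℂ → ℂ) (K : ℂ → ℂ → ℂ) : Prop where
  diff_A : Differentiable ℂ A
  diff_B : Differentiable ℂ B
  conj_A : ∀ z, A (conj z) = conj (A z)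
  conj_B : ∀ z, B (conj z) = conj (B z)
  ne_zero : ∀ z, A z ≠ 0 ∨ B z ≠ 0
  nonneg : ∀ z : ℂ, 0 ≤ z.im → 0 ≤ (A z * conj (B z)).im
  diff_K : ∀ a, Differentiable ℂ (K a)
  conj_K : ∀ a b, K (conj a) (conj b) = conj (K a b)
  kernel : ∀ a z, (a - z) * K a z = A a * B z - B a * A z

namespace IsKernelPair

variable {A B : ℂ → ℂ} {K : ℂ → ℂ → ℂ}

local notation "𝔼" => fun z => A z + I * B z

lemma sharp_eq (h : IsKernelPair A B K) (z : ℂ) : sharp 𝔼 z = A z - I * B z := by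
  simp [sharp, h.conj_A, h.conj_B]
  ring

/-- This is `|A + iB|² - |A - iB|² = 4 Im (A conj B)`. -/
lemma norm_sharp_le (h : IsKernelPair A B K) {z : ℂ} (hz : 0 ≤ z.im) :
    ‖sharp 𝔼 z‖ ≤ ‖A z + I * B z‖ := by
  rw [h.sharp_eq]
  refine abs_le_of_sq_le_sq' ?_ (norm_nonneg _) |>.2
  have h1 := h.nonneg z hz
  rw [← normSq_eq_norm_sq, ← normSq_eq_norm_sq, normSq_apply, normSq_apply]
  simp only [mul_im, conj_re, conj_im, sub_re, sub_im, add_re, add_im, mul_re, I_re, I_im] at h1 ⊢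
  nlinarith

/-- A zero of `E` here would also be a zero of `E^♯`, hence of both `A` and `B`. Including the real
line is what makes `f / E` continuous up to the boundary. -/
lemma hb_ne_zero (h : IsKernelPair A B K) {z : ℂ} (hz : 0 ≤ z.im) : A z + I * B z ≠ 0 := by
  intro h0
  have h1 := h.norm_sharp_le hz
  rw [h0, norm_zero, norm_le_zero_iff, h.sharp_eq] at h1
  have hA : A z = 0 := by linear_combination (h0 + h1) / 2
  have hB : B z = 0 := by
    have h2 : I * B z = 0 := by linear_combination (h0 - h1) / 2
    simpa using h2
  exact (h.ne_zero z).elim (fun h => h hA) fun h => h hB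

lemma differentiable_hb (h : IsKernelPair A B K) : Differentiable ℂ 𝔼 :=
  h.diff_A.add (h.diff_B.const_mul I)

lemma isHermiteBiehler (h : IsKernelPair A B K) : IsHermiteBiehler 𝔼 where
  entire := h.differentiable_hb
  ne_zero z hz := h.hb_ne_zero hz.le
  norm_le z hz := by
    have := h.norm_sharp_le hz.le
    rwa [sharp, RCLike.norm_conj] at this

lemma continuousOn_div (h : IsKernelPair A B K) {f : ℂ → ℂ} (hf : Differentiable ℂ f) :
    ContinuousOn (fun z => f z / (A z + I * B z)) {z | 0 ≤ z.im} :=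
  hf.continuous.continuousOn.div h.differentiable_hb.continuous.continuousOn
    fun _ hz => h.hb_ne_zero hz

lemma differentiableAt_div (h : IsKernelPair A B K) {f : ℂ → ℂ} (hf : Differentiable ℂ f) {z : ℂ}
    (hz : 0 ≤ z.im) : DifferentiableAt ℂ (fun z => f z / (A z + I * B z)) z :=
  (hf z).div (h.differentiable_hb z) (h.hb_ne_zero hz)

/-- The kernel in terms of the Hermite-Biehler function. -/
lemma sub_mul_kernel (h : IsKernelPair A B K) (a z : ℂ) :
    2 * I * ((a - z) * K a z) = sharp 𝔼 a * (A z + I * B z) - (A a + I * B a) * sharp 𝔼 z := by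
  rw [h.kernel, h.sharp_eq, h.sharp_eq]
  ring

lemma sharp_kernel (h : IsKernelPair A B K) (a : ℂ) : sharp (K a) = K (conj a) := by
  funext z
  rw [sharp, ← h.conj_K, conj_conj]

/-- Dividing `sub_mul_kernel` by `E z` and using `|E^♯ z| ≤ |E z|` bounds `|z - a| |K a z / E z|` on
the closed half plane. The point `a` may lie anywhere, as `K a` is entire. -/
lemma memHardyTwo_kernel_div (h : IsKernelPair A B K) (a : ℂ) :
    MemHardyTwo fun z => K a z / (A z + I * B z) := by
  refine (isHardyCont_of_norm_sub_mul_le (a := a) (c := ‖sharp 𝔼 a‖ + ‖A a + I * B a‖)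
    (h.continuousOn_div (h.diff_K a)) (fun z hz =>
      (h.differentiableAt_div (h.diff_K a) (le_of_lt hz)).differentiableWithinAt)
    fun z hz => ?_).memHardyTwo
  have hE := norm_pos_iff.2 (h.hb_ne_zero hz)
  rw [norm_div, ← mul_div_assoc, div_le_iff₀ hE, norm_sub_rev, ← norm_mul]
  have h1 := congrArg norm (h.sub_mul_kernel a z)
  rw [norm_mul, norm_mul, norm_I, mul_one, RCLike.norm_ofNat] at h1
  have h2 := norm_sub_le (sharp 𝔼 a * (A z + I * B z)) ((A a + I * B a) * sharp 𝔼 z)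
  rw [norm_mul, norm_mul] at h2
  have h3 := mul_le_mul_of_nonneg_left (h.norm_sharp_le hz) (norm_nonneg (A a + I * B a))
  have h4 := norm_nonneg ((a - z) * K a z)
  rw [add_mul]
  linarith

lemma memDeBranges_kernel (h : IsKernelPair A B K) (a : ℂ) : MemDeBranges 𝔼 (K a) := by
  refine ⟨h.diff_K a, h.memHardyTwo_kernel_div a, ?_⟩
  rw [h.sharp_kernel]
  exact h.memHardyTwo_kernel_div (conj a)

lemma differentiable_sharp {f : ℂ → ℂ} (hf : Differentiable ℂ f) : Differentiable ℂ (sharp f) :=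
  fun z => differentiableAt_conj_conj_iff.2 (hf (conj z))

/-- The reproducing property, at points of the closed upper half plane. -/
lemma reproducing_of_im_nonneg (h : IsKernelPair A B K) {f : ℂ → ℂ} (hf : MemDeBranges 𝔼 f)
    {a : ℂ} (ha : 0 ≤ a.im) :
    Integrable (fun x : ℝ => K a x * f x / ((‖A x + I * B x‖ ^ 2 : ℝ) : ℂ)) ∧
      ∫ x : ℝ, K a x * f x / ((‖A x + I * B x‖ ^ 2 : ℝ) : ℂ) = Real.pi * f a := by
  obtain ⟨hfd, hf₁, hf₂⟩ := hf
  have hfs := differentiable_sharp hfd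
  set F₁ : ℂ → ℂ := fun z => f z / (A z + I * B z) with hF₁
  set F₂ : ℂ → ℂ := fun z => sharp f z / (A z + I * B z) with hF₂
  have hEs : ∀ x : ℝ, sharp 𝔼 x = conj (A x + I * B x) := fun x => by
    rw [sharp, conj_ofReal]
  have hreal : a.im = 0 → conj a = a := conj_eq_iff_im.2
  obtain ⟨i, e⟩ := (hf₁.isHardyCont (h.continuousOn_div hfd)).integral_combination
    (hf₂.isHardyCont (h.continuousOn_div hfs)) (c₁ := A a + I * B a) (c₂ := sharp 𝔼 a) (w := f a)
    ha (h.differentiableAt_div hfd ha) (fun _ => h.differentiableAt_div hfs ha)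
    (mul_div_cancel₀ _ (h.hb_ne_zero ha)) (fun ha0 => by
      have h1 : sharp 𝔼 a = conj (A a + I * B a) := by rw [sharp, hreal ha0]
      have h2 : conj (sharp f a) = f a := by rw [sharp, hreal ha0, conj_conj]
      change sharp 𝔼 a * conj (sharp f a / (A a + I * B a)) = f a
      rw [h1, map_div₀, h2]
      exact mul_div_cancel₀ _ ((_root_.map_ne_zero _).2 (h.hb_ne_zero ha)))
  -- On the real line `|E|² = E conj E`, `E^♯ = conj E` and `f = conj f^♯`, so the kernel identity
  -- splits the integrand into the two Cauchy fractions.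
  have hx : (fun x : ℝ => K a x * f x / ((‖A x + I * B x‖ ^ 2 : ℝ) : ℂ)) =ᵐ[volume] fun x : ℝ =>
      (2 * I)⁻¹ * (((A a + I * B a) * F₁ x - sharp 𝔼 a * conj (F₂ x)) / (x - a)) := by
    have h0 : ∀ᵐ x : ℝ, x ≠ a.re := by simp [ae_iff, measure_singleton]
    filter_upwards [h0] with x hx
    have h1 : (x : ℂ) - a ≠ 0 := fun h => hx (by simpa [sub_eq_zero] using congrArg re h)
    have hE : A x + I * B x ≠ 0 := h.hb_ne_zero (by simp)
    have hE' : conj (A x + I * B x) ≠ 0 := (_root_.map_ne_zero _).2 hE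
    have hk := h.sub_mul_kernel a x
    rw [hEs] at hk
    have hs : conj (sharp f x) = f x := by rw [sharp, conj_ofReal, conj_conj]
    have h2 : ((‖A x + I * B x‖ ^ 2 : ℝ) : ℂ) = (A x + I * B x) * conj (A x + I * B x) := by
      rw [mul_conj, normSq_eq_norm_sq]
    have hK : K a x = (2 * I)⁻¹ * ((A a + I * B a) * conj (A x + I * B x) -
        sharp 𝔼 a * (A x + I * B x)) / (x - a) := by
      rw [eq_div_iff h1, eq_inv_mul_iff_mul_eq₀ (by simp)]
      linear_combination -hk
    rw [h2, hK, hF₁, hF₂]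
    simp only
    rw [map_div₀, hs]
    field_simp
  refine ⟨(i.const_mul _).congr hx.symm, ?_⟩
  rw [integral_congr_ae hx, integral_const_mul, e]
  field_simp

lemma memDeBranges_sharp {f : ℂ → ℂ} (hf : MemDeBranges 𝔼 f) : MemDeBranges 𝔼 (sharp f) := by
  have hs : sharp (sharp f) = f := by
    funext z
    simp [sharp]
  refine ⟨differentiable_sharp hf.1, hf.2.2, ?_⟩
  rw [hs]
  exact hf.2.1

/-- Conjugating the integral and passing from `f` to `f^♯` and from `a` to `conj a` reduces the
lower half plane to the upper one. -/
lemma reproducing (h : IsKernelPair A B K) {f : ℂ → ℂ} (hf : MemDeBranges 𝔼 f) (a : ℂ) :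
    Integrable (fun x : ℝ => K a x * f x / ((‖A x + I * B x‖ ^ 2 : ℝ) : ℂ)) ∧
      ∫ x : ℝ, K a x * f x / ((‖A x + I * B x‖ ^ 2 : ℝ) : ℂ) = Real.pi * f a := by
  rcases le_total 0 a.im with ha | ha
  · exact h.reproducing_of_im_nonneg hf ha
  · obtain ⟨i, e⟩ := h.reproducing_of_im_nonneg (memDeBranges_sharp hf) (a := conj a)
      (by simpa using ha)
    have hx : ∀ x : ℝ, K a x * f x / ((‖A x + I * B x‖ ^ 2 : ℝ) : ℂ) =
        conj (K (conj a) x * sharp f x / ((‖A x + I * B x‖ ^ 2 : ℝ) : ℂ)) := by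
      intro x
      have h1 := h.conj_K (conj a) x
      rw [conj_conj, conj_ofReal] at h1
      rw [map_div₀, map_mul, ← h1, sharp, conj_ofReal, conj_conj, conj_ofReal]
    simp_rw [hx]
    refine ⟨conjCLE.toContinuousLinearMap.integrable_comp i, ?_⟩
    rw [integral_conj, e, map_mul, conj_ofReal, sharp, conj_conj, conj_conj]

lemma isReproducingKernel (h : IsKernelPair A B K) :
    IsReproducingKernel 𝔼 fun a b => K (conj a) b := by
  intro a
  refine ⟨h.memDeBranges_kernel (conj a), fun f hf => ?_⟩
  obtain ⟨i, e⟩ := h.reproducing hf a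
  have hx : ∀ x : ℝ, deBrangesIntegrand 𝔼 (fun b => K (conj a) b) f x =
      K a x * f x / ((‖A x + I * B x‖ ^ 2 : ℝ) : ℂ) := by
    intro x
    have h1 := h.conj_K (conj a) x
    rw [conj_conj, conj_ofReal] at h1
    rw [deBrangesIntegrand, h1]
  have hx' := funext hx
  constructor
  · change Integrable (fun x => deBrangesIntegrand 𝔼 (fun b => K (conj a) b) f x)
    rw [hx']
    exact i
  · rw [deBrangesInner]
    simp_rw [hx]
    rw [e, ← mul_assoc, one_div, inv_mul_cancel₀ (by simp [Real.pi_ne_zero]), one_mul]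

end IsKernelPair

end DeBranges

/-! ### Weak limits of the Hamiltonians -/

section Hamiltonian

/-- The real symmetric matrix with the entries `h 0, h 1, h 2`. -/
noncomputable def hamiltonian (h : Fin 3 → ℝ) : Matrix (Fin 2) (Fin 2) ℂ :=
  !![(h 0 : ℂ), (h 1 : ℂ); (h 1 : ℂ), (h 2 : ℂ)]

/-- The coefficient `𝒥⁻¹ H = -𝒥 H` of the canonical system. -/
noncomputable def coefficient (h : Fin 3 → ℝ) : Matrix (Fin 2) (Fin 2) ℂ :=
  -(matJ * hamiltonian h)

/-- Linearity in three real entries reduces measurability, norm bounds and weak convergence of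
matrix coefficients to scalar functions. -/
lemma coefficient_eq_sum (h : Fin 3 → ℝ) :
    coefficient h = ∑ i, h i • coefficient (Pi.single i 1) := by
  ext i j
  fin_cases i <;> fin_cases j <;>
    simp [coefficient, hamiltonian, matJ, Fin.sum_univ_three]

lemma matJ_mul_eq_iff (h : Fin 3 → ℝ) (D R : Matrix (Fin 2) (Fin 2) ℂ) (z : ℂ) :
    matJ * D = z • (hamiltonian h * R) ↔ D = z • (coefficient h * R) := by
  constructor
  · intro e
    have := congrArg (fun X => -(matJ * X)) e
    simpa [← mul_assoc, matJ_mul_matJ, coefficient] using this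
  · rintro rfl
    simp [coefficient, ← mul_assoc, matJ_mul_matJ]

lemma posSemidef_hamiltonian {h : Fin 3 → ℝ}
    (hh : ∀ x y : ℝ, 0 ≤ h 0 * x ^ 2 + 2 * h 1 * (x * y) + h 2 * y ^ 2) :
    (hamiltonian h).PosSemidef := by
  refine Matrix.PosSemidef.of_dotProduct_mulVec_nonneg ?_ fun x => ?_
  · ext i j
    fin_cases i <;> fin_cases j <;> simp [hamiltonian]
  · have h1 := hh (x 0).re (x 1).re
    have h2 := hh (x 0).im (x 1).im
    have e : star x ⬝ᵥ (hamiltonian h).mulVec x =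
        ((h 0 * (x 0).re ^ 2 + 2 * h 1 * ((x 0).re * (x 1).re) + h 2 * (x 1).re ^ 2 +
          (h 0 * (x 0).im ^ 2 + 2 * h 1 * ((x 0).im * (x 1).im) + h 2 * (x 1).im ^ 2) : ℝ) : ℂ) := by
      apply Complex.ext
      · simp [hamiltonian, Matrix.mulVec, dotProduct, Fin.sum_univ_two, pow_two]
        ring
      · simp [hamiltonian, Matrix.mulVec, dotProduct, Fin.sum_univ_two, pow_two]
        ring
    rw [e]
    exact_mod_cast add_nonneg h1 h2

/-- The entries of the discrete Hamiltonian. -/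
noncomputable def discreteEntries (μ : Measure ℝ) (x₀ : ℝ) (l : ℕ) : Fin 3 → ℝ :=
  ![(orthPoly μ l).eval x₀ ^ 2, -((orthPoly μ l).eval x₀ * secondKind μ l x₀),
    secondKind μ l x₀ ^ 2]

lemma discreteH_eq (μ : Measure ℝ) (x₀ : ℝ) (l : ℕ) :
    discreteH μ x₀ l = hamiltonian (discreteEntries μ x₀ l) := by
  ext i j
  fin_cases i <;> fin_cases j <;> simp [discreteH, hamiltonian, discreteEntries]

lemma discreteQ_succ (μ : Measure ℝ) (x₀ : ℝ) (z : ℂ) (l : ℕ) :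
    discreteQ μ x₀ z (l + 1) = discreteQ μ x₀ z l +
      z • (coefficient (discreteEntries μ x₀ l) * discreteQ μ x₀ z l) := by
  rw [discreteQ, discreteH_eq, coefficient, sub_eq_add_neg, neg_mul, smul_neg, mul_assoc]

lemma abs_discreteEntries_le {μ : Measure ℝ} {x₀ M : ℝ}
    (hM : ∀ l, (orthPoly μ l).eval x₀ ^ 2 + secondKind μ l x₀ ^ 2 ≤ M) (l : ℕ) (i : Fin 3) :
    |discreteEntries μ x₀ l i| ≤ M := by
  have h := hM l
  rw [abs_le]
  fin_cases i <;> simp [discreteEntries] <;> constructor <;>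
    nlinarith [sq_nonneg ((orthPoly μ l).eval x₀ - secondKind μ l x₀),
      sq_nonneg ((orthPoly μ l).eval x₀ + secondKind μ l x₀), sq_nonneg ((orthPoly μ l).eval x₀),
      sq_nonneg (secondKind μ l x₀)]

lemma discreteEntries_form_nonneg (μ : Measure ℝ) (x₀ : ℝ) (l : ℕ) (x y : ℝ) :
    0 ≤ discreteEntries μ x₀ l 0 * x ^ 2 + 2 * discreteEntries μ x₀ l 1 * (x * y) +
      discreteEntries μ x₀ l 2 * y ^ 2 := by
  simp only [discreteEntries, Matrix.cons_val]
  nlinarith [sq_nonneg ((orthPoly μ l).eval x₀ * x - secondKind μ l x₀ * y)]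

/-- Weak limits of the scaled discrete Hamiltonians. -/
lemma exists_weakLimit_discreteEntries {μ : Measure ℝ} {x₀ M : ℝ}
    (hM : ∀ l, (orthPoly μ l).eval x₀ ^ 2 + secondKind μ l x₀ ^ 2 ≤ M) :
    ∃ (n : ℕ → ℕ) (h : ℝ → Fin 3 → ℝ), StrictMono n ∧ (∀ k, 0 < n k) ∧
      (∀ i, Measurable fun t => h t i) ∧ (∀ t i, |h t i| ≤ M) ∧
      (∀ i, ∀ g : ℝ → ℝ, MemLp g 2 (volume.restrict (Set.Icc (0 : ℝ) 1)) →
        Tendsto (fun k => ∫ t in Set.Icc (0 : ℝ) 1,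
          discreteEntries μ x₀ ⌊t * n k⌋₊ i * g t) atTop
          (𝓝 (∫ t in Set.Icc (0 : ℝ) 1, h t i * g t))) := by
  have hM0 : 0 ≤ M := by
    have := hM 0
    nlinarith [sq_nonneg ((orthPoly μ 0).eval x₀), sq_nonneg (secondKind μ 0 x₀)]
  have hmeas : ∀ (i : Fin 3) (N : ℕ),
      Measurable fun t : ℝ => discreteEntries μ x₀ ⌊t * (N + 1 : ℕ)⌋₊ i := fun i N =>
    (measurable_from_nat (f := fun l => discreteEntries μ x₀ l i)).comp
      (Nat.measurable_floor.comp (measurable_id.mul_const _))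
  have hb : ∀ (i : Fin 3) (N : ℕ) (t : ℝ),
      |discreteEntries μ x₀ ⌊t * (N + 1 : ℕ)⌋₊ i| ≤ M := fun i N t =>
    abs_discreteEntries_le hM _ i
  -- Three nested extractions, one for each entry; earlier limits persist along later subsequences.
  -- The shift `N + 1` keeps the scales positive.
  obtain ⟨φ₀, g₀, hφ₀, hg₀, hgM₀, hlim₀⟩ := exists_subseq_tendsto_integral_mul
    (ν := volume.restrict (Set.Icc (0 : ℝ) 1)) (hmeas 0) (hb 0) hM0
  obtain ⟨φ₁, g₁, hφ₁, hg₁, hgM₁, hlim₁⟩ := exists_subseq_tendsto_integral_mul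
    (ν := volume.restrict (Set.Icc (0 : ℝ) 1)) (fun N => hmeas 1 (φ₀ N)) (fun N => hb 1 (φ₀ N)) hM0
  obtain ⟨φ₂, g₂, hφ₂, hg₂, hgM₂, hlim₂⟩ := exists_subseq_tendsto_integral_mul
    (ν := volume.restrict (Set.Icc (0 : ℝ) 1)) (fun N => hmeas 2 (φ₀ (φ₁ N)))
    (fun N => hb 2 (φ₀ (φ₁ N))) hM0
  refine ⟨fun k => φ₀ (φ₁ (φ₂ k)) + 1, fun t => ![g₀ t, g₁ t, g₂ t],
    fun a b hab => Nat.succ_lt_succ (hφ₀ (hφ₁ (hφ₂ hab))), fun k => Nat.succ_pos _, ?_, ?_, ?_⟩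
  · intro i
    fin_cases i
    exacts [hg₀, hg₁, hg₂]
  · intro t i
    fin_cases i
    exacts [hgM₀ t, hgM₁ t, hgM₂ t]
  · intro i g hg
    fin_cases i
    · exact (hlim₀ g hg).comp (hφ₁.tendsto_atTop.comp hφ₂.tendsto_atTop)
    · exact (hlim₁ g hg).comp hφ₂.tendsto_atTop
    · exact hlim₂ g hg

/-- Weak limits of positive semidefinite forms are positive semidefinite. -/
lemma ae_form_nonneg {f : ℕ → ℝ → Fin 3 → ℝ} {h : ℝ → Fin 3 → ℝ} {M : ℝ}
    (hf : ∀ k i, Measurable fun t => f k t i) (hfM : ∀ k t i, |f k t i| ≤ M)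
    (hm : ∀ i, Measurable fun t => h t i) (hM : ∀ t i, |h t i| ≤ M)
    (hnn : ∀ k t (x y : ℝ), 0 ≤ f k t 0 * x ^ 2 + 2 * f k t 1 * (x * y) + f k t 2 * y ^ 2)
    (hlim : ∀ i, ∀ g : ℝ → ℝ, MemLp g 2 (volume.restrict (Set.Icc (0 : ℝ) 1)) →
        Tendsto (fun k => ∫ t in Set.Icc (0 : ℝ) 1, f k t i * g t) atTop
          (𝓝 (∫ t in Set.Icc (0 : ℝ) 1, h t i * g t))) :
    ∀ᵐ t ∂(volume.restrict (Set.Icc (0 : ℝ) 1)), ∀ x y : ℝ,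
      0 ≤ h t 0 * x ^ 2 + 2 * h t 1 * (x * y) + h t 2 * y ^ 2 := by
  set ν := volume.restrict (Set.Icc (0 : ℝ) 1)
  have hint : ∀ u : ℝ → ℝ, Measurable u → (∀ t, |u t| ≤ M) → ∀ s, IntegrableOn u s ν :=
    fun u hu hb s => (Integrable.of_bound (μ := ν) hu.aestronglyMeasurable M
      (ae_of_all _ hb)).integrableOn
  have key : ∀ x y : ℝ, ∀ᵐ t ∂ν,
      0 ≤ h t 0 * x ^ 2 + 2 * h t 1 * (x * y) + h t 2 * y ^ 2 := by
    intro x y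
    have hset : ∀ s, MeasurableSet s → ∀ i, Tendsto (fun k => ∫ t in s, f k t i ∂ν) atTop
        (𝓝 (∫ t in s, h t i ∂ν)) := by
      intro s hs i
      have h1 := hlim i (s.indicator fun _ => 1)
        (memLp_indicator_const 2 hs 1 (Or.inr (by finiteness)))
      have e : ∀ u : ℝ → ℝ, ∫ t, u t * s.indicator (fun _ => 1) t ∂ν = ∫ t in s, u t ∂ν :=
        fun u => by
          rw [← integral_indicator hs]
          congr 1 with t
          by_cases hts : t ∈ s <;> simp [hts]
      exact (h1.congr fun k => e fun t => f k t i).trans_eq (congrArg 𝓝 (e fun t => h t i))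
    have hform : ∀ u : ℝ → Fin 3 → ℝ, (∀ i, Measurable fun t => u t i) → (∀ t i, |u t i| ≤ M) →
        ∀ s, ∫ t in s, (u t 0 * x ^ 2 + 2 * u t 1 * (x * y) + u t 2 * y ^ 2) ∂ν =
          (∫ t in s, u t 0 ∂ν) * x ^ 2 + 2 * (∫ t in s, u t 1 ∂ν) * (x * y) +
            (∫ t in s, u t 2 ∂ν) * y ^ 2 := by
      intro u hu hb s
      have i0 := (hint _ (hu 0) (fun t => hb t 0) s).integrable.mul_const (x ^ 2)
      have i1 := ((hint _ (hu 1) (fun t => hb t 1) s).integrable.const_mul 2).mul_const (x * y)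
      have i2 := (hint _ (hu 2) (fun t => hb t 2) s).integrable.mul_const (y ^ 2)
      rw [integral_add (by exact i0.add i1) i2, integral_add i0 i1, integral_mul_const,
        integral_mul_const, integral_mul_const, integral_const_mul]
    refine ae_nonneg_of_forall_setIntegral_nonneg ?_ fun s hs _ => ?_
    · exact (((integrableOn_univ.1 (hint _ (hm 0) (fun t => hM t 0) Set.univ)).mul_const
        (x ^ 2)).add (((integrableOn_univ.1 (hint _ (hm 1) (fun t => hM t 1)
          Set.univ)).const_mul 2).mul_const (x * y))).add
        ((integrableOn_univ.1 (hint _ (hm 2) (fun t => hM t 2) Set.univ)).mul_const (y ^ 2))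
    · rw [hform h hm hM]
      refine ge_of_tendsto ((((hset s hs 0).mul_const (x ^ 2)).add
        (((hset s hs 1).const_mul 2).mul_const (x * y))).add ((hset s hs 2).mul_const (y ^ 2)))
        (Eventually.of_forall fun k => ?_)
      rw [← hform (f k) (hf k) (hfM k)]
      exact integral_nonneg fun t => hnn k t x y
  -- The exceptional null set in `key` depends on the vector. Rational vectors give one common null
  -- set, and density and continuity give the rest.
  have hall : ∀ᵐ t ∂ν, ∀ q : ℚ × ℚ,
      0 ≤ h t 0 * (q.1 : ℝ) ^ 2 + 2 * h t 1 * ((q.1 : ℝ) * q.2) + h t 2 * (q.2 : ℝ) ^ 2 :=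
    ae_all_iff.2 fun q => key q.1 q.2
  filter_upwards [hall] with t ht x y
  refine (Rat.denseRange_cast (𝕜 := ℝ)).induction_on₂
    (p := fun x y => 0 ≤ h t 0 * x ^ 2 + 2 * h t 1 * (x * y) + h t 2 * y ^ 2) ?_
    (fun q r => ht (q, r)) x y
  exact isClosed_le continuous_const (by fun_prop)

/-- Weak convergence of bounded functions, tested against continuous vector valued functions. -/
lemma tendsto_integral_smul_of_weak {E : Type*} [NormedAddCommGroup E] [NormedSpace ℝ E]
    [FiniteDimensional ℝ E] {f : ℕ → ℝ → ℝ} {h : ℝ → ℝ} {M : ℝ}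
    (hf : ∀ k, Measurable (f k)) (hfM : ∀ k t, |f k t| ≤ M) (hm : Measurable h)
    (hM : ∀ t, |h t| ≤ M)
    (hlim : ∀ g : ℝ → ℝ, MemLp g 2 (volume.restrict (Set.Icc (0 : ℝ) 1)) →
        Tendsto (fun k => ∫ t in Set.Icc (0 : ℝ) 1, f k t * g t) atTop
          (𝓝 (∫ t in Set.Icc (0 : ℝ) 1, h t * g t)))
    {g : ℝ → E} (hg : ContinuousOn g (Set.Icc 0 1)) {t : ℝ} (ht : t ∈ Set.Icc (0 : ℝ) 1) :
    Tendsto (fun k => ∫ s in (0 : ℝ)..t, f k s • g s) atTop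
      (𝓝 (∫ s in (0 : ℝ)..t, h s • g s)) := by
  have hsub : Set.Ioc 0 t ⊆ Set.Icc 0 1 := fun s hs => ⟨hs.1.le, hs.2.trans ht.2⟩
  -- In coordinates, cutting off at `t` yields scalar test functions that are bounded, hence in
  -- `L²`.
  set b := Module.finBasis ℝ E
  set c : Fin (Module.finrank ℝ E) → ℝ → ℝ := fun i s => b.coord i (g s) with hc
  have hcc : ∀ i, ContinuousOn (c i) (Set.Icc 0 1) := fun i =>
    ((b.coord i).continuous_of_finiteDimensional).comp_continuousOn hg
  have hexp : ∀ u : ℝ → ℝ, Measurable u → (∀ s, |u s| ≤ M) →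
      ∫ s in (0 : ℝ)..t, u s • g s = ∑ i, (∫ s in Set.Icc (0 : ℝ) 1,
        u s * (Set.Ioc 0 t).indicator (c i) s) • b i := by
    intro u hu hb
    have h1 : ∀ s, u s • g s = ∑ i, (u s * c i s) • b i := fun s => by
      calc u s • g s = u s • ∑ i, b.repr (g s) i • b i := by rw [b.sum_repr]
        _ = _ := by
          simp only [Finset.smul_sum, smul_smul]
          rfl
    simp_rw [h1]
    rw [intervalIntegral.integral_of_le ht.1, integral_finsetSum]
    · refine Finset.sum_congr rfl fun i _ => ?_
      rw [integral_smul_const]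
      congr 1
      simp_rw [← Set.indicator_mul_right]
      rw [setIntegral_indicator measurableSet_Ioc, Set.inter_eq_right.2 hsub]
    · intro i _
      refine Integrable.smul_const ?_ _
      exact (((hcc i).integrableOn_compact isCompact_Icc).mono_set hsub).bdd_mul
        hu.aestronglyMeasurable (ae_of_all _ hb)
  rw [hexp h hm hM]
  simp_rw [fun k => hexp (f k) (hf k) (hfM k)]
  refine tendsto_finsetSum _ fun i _ => Tendsto.smul_const ?_ _
  refine hlim _ ?_
  obtain ⟨C, hC⟩ := isCompact_Icc.exists_bound_of_continuousOn (hcc i)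
  refine MemLp.of_bound (C := C) ?_ ?_
  · exact ((aestronglyMeasurable_indicator_iff measurableSet_Ioc).2
      (((hcc i).mono hsub).aestronglyMeasurable measurableSet_Ioc)).restrict
  · refine (ae_restrict_iff' measurableSet_Icc).2 (ae_of_all _ fun s hs => ?_)
    by_cases hs' : s ∈ Set.Ioc 0 t
    · rw [Set.indicator_of_mem hs']
      exact hC s hs
    · rw [Set.indicator_of_notMem hs', norm_zero]
      exact (norm_nonneg _).trans (hC 0 (by simp))

end Hamiltonian

/-! ### The scaling limit of the discrete systems -/

section ScalingLimit

attribute [local instance] Matrix.linftyOpNormedRing Matrix.linftyOpNormedAlgebra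

lemma norm_entry_le (A : Matrix (Fin 2) (Fin 2) ℂ) (i j : Fin 2) : ‖A i j‖ ≤ ‖A‖ := by
  rw [Matrix.linfty_opNorm_def]
  have h1 : ‖A i j‖₊ ≤ ∑ j, ‖A i j‖₊ :=
    Finset.single_le_sum (f := fun j => ‖A i j‖₊) (fun _ _ => zero_le) (Finset.mem_univ j)
  exact_mod_cast h1.trans (Finset.le_sup (f := fun i => ∑ j, ‖A i j‖₊) (Finset.mem_univ i))

lemma norm_le_sum_entries (A : Matrix (Fin 2) (Fin 2) ℂ) : ‖A‖ ≤ ∑ i, ∑ j, ‖A i j‖ := by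
  rw [Matrix.linfty_opNorm_def]
  have h : (Finset.univ.sup fun i => ∑ j, ‖A i j‖₊) ≤ ∑ i, ∑ j, ‖A i j‖₊ :=
    Finset.sup_le fun i _ => Finset.single_le_sum (f := fun i => ∑ j, ‖A i j‖₊)
      (fun _ _ => zero_le) (Finset.mem_univ i)
  exact_mod_cast h

/-- The entries of a matrix, as continuous linear maps. -/
noncomputable def entryCLM (i j : Fin 2) : Matrix (Fin 2) (Fin 2) ℂ →L[ℂ] ℂ :=
  LinearMap.toContinuousLinearMap (Matrix.entryLinearMap ℂ ℂ i j)

lemma hasDerivAt_matrix_iff {R : ℝ → Matrix (Fin 2) (Fin 2) ℂ} {D : Matrix (Fin 2) (Fin 2) ℂ}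
    {t : ℝ} : HasDerivAt R D t ↔ ∀ i j, HasDerivAt (fun s => R s i j) (D i j) t := by
  constructor
  · intro h i j
    exact ((entryCLM i j).restrictScalars ℝ).hasFDerivAt.comp_hasDerivAt t h
  · intro h
    have e : ∀ A : Matrix (Fin 2) (Fin 2) ℂ,
        A = ∑ i, ∑ j, A i j • Matrix.single i j (1 : ℂ) := fun A => by
      conv_lhs => rw [Matrix.matrix_eq_sum_single A]
      simp
    rw [e D, show R = fun s => ∑ i, ∑ j, R s i j • Matrix.single i j (1 : ℂ) from
      funext fun s => e (R s)]
    refine HasDerivAt.fun_sum fun i _ => HasDerivAt.fun_sum fun j _ => ?_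
    exact (h i j).smul_const _

/-- Absolute continuity is convergence to zero of sums of increments, and the matrix distance is at
most the sum of the four entry distances. -/
lemma absolutelyContinuousOnInterval_matrix {R : ℝ → Matrix (Fin 2) (Fin 2) ℂ} {a b : ℝ}
    (h : ∀ i j, AbsolutelyContinuousOnInterval (fun t => R t i j) a b) :
    AbsolutelyContinuousOnInterval R a b := by
  have h1 := tendsto_finsetSum Finset.univ fun i (_ : i ∈ Finset.univ) =>
    tendsto_finsetSum Finset.univ fun j (_ : j ∈ Finset.univ) => h i j
  simp only [Finset.sum_const_zero] at h1
  refine squeeze_zero (fun E => Finset.sum_nonneg fun _ _ => dist_nonneg) (fun E => ?_) h1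
  have h2 : ∀ A D : Matrix (Fin 2) (Fin 2) ℂ, dist A D ≤ ∑ i, ∑ j, dist (A i j) (D i j) :=
    fun A D => by
      rw [dist_eq_norm]
      refine (norm_le_sum_entries _).trans (le_of_eq ?_)
      simp [dist_eq_norm]
  refine (Finset.sum_le_sum fun k _ => h2 _ _).trans_eq ?_
  rw [Finset.sum_comm]
  exact Finset.sum_congr rfl fun i _ => Finset.sum_comm

/-- Existence of the scaling limit of the discrete systems. -/
lemma exists_scalingLimit {μ : Measure ℝ} {x₀ M : ℝ}
    (hM : ∀ l, (orthPoly μ l).eval x₀ ^ 2 + secondKind μ l x₀ ^ 2 ≤ M) :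
    ∃ (n : ℕ → ℕ) (H : ℝ → Matrix (Fin 2) (Fin 2) ℂ)
      (Q : ℂ → ℝ → Matrix (Fin 2) (Fin 2) ℂ) (C : ℝ),
      StrictMono n ∧ (∀ k, 0 < n k) ∧
      (∀ i j, Measurable fun t => H t i j) ∧
      (∀ t i j, ‖H t i j‖ ≤ M) ∧
      (∀ᵐ t ∂(volume.restrict (Set.Icc (0 : ℝ) 1)), (H t).PosSemidef) ∧
      (∀ a, IsCanonicalSolution H a (Q a)) ∧
      (∀ a R, IsCanonicalSolution H a R → Set.EqOn R (Q a) (Set.Icc 0 1)) ∧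
      (∀ a, ∀ ε > 0, ∀ᶠ k in atTop, ∀ t ∈ Set.Icc (0 : ℝ) 1, ∀ i j,
        ‖discreteQ μ x₀ (a / (n k : ℂ)) ⌊t * (n k : ℝ)⌋₊ i j - Q a t i j‖ < ε) ∧
      (∀ i j, Differentiable ℂ fun a => Q a 1 i j) ∧
      (∀ z N i j, ‖discreteQ μ x₀ z N i j‖ ≤ Real.exp (N * (‖z‖ * C))) := by
  obtain ⟨n, h, hn, hn0, hm, hb, hlim⟩ := exists_weakLimit_discreteEntries hM
  have hM0 : 0 ≤ M := (abs_nonneg _).trans (hb 0 0)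
  set B : ℝ → Matrix (Fin 2) (Fin 2) ℂ := fun t => coefficient (h t) with hB
  set b : ℕ → Matrix (Fin 2) (Fin 2) ℂ := fun l => coefficient (discreteEntries μ x₀ l) with hbdef
  -- One norm bound for the discrete and the limiting coefficients, valid whenever the three entries
  -- are at most `M` in modulus.
  set C : ℝ := ∑ i : Fin 3, M * ‖coefficient (Pi.single i 1)‖ with hC
  have hnorm : ∀ u : Fin 3 → ℝ, (∀ i, |u i| ≤ M) → ‖coefficient u‖ ≤ C := fun u hu => by
    rw [coefficient_eq_sum, hC]
    refine norm_sum_le_of_le _ fun i _ => ?_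
    rw [norm_smul, Real.norm_eq_abs]
    exact mul_le_mul_of_nonneg_right (hu i) (norm_nonneg _)
  have hBC : ∀ t, ‖B t‖ ≤ C := fun t => hnorm _ (hb t)
  have hbC : ∀ l, ‖b l‖ ≤ C := fun l => hnorm _ (abs_discreteEntries_le hM l)
  have hC0 : 0 ≤ C := (norm_nonneg _).trans (hBC 0)
  have hBm : StronglyMeasurable B := by
    rw [hB]
    simp_rw [coefficient_eq_sum (h _), Fin.sum_univ_three]
    exact (((hm 0).stronglyMeasurable.smul_const _).add
      ((hm 1).stronglyMeasurable.smul_const _)).add ((hm 2).stronglyMeasurable.smul_const _)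
  have hfm : ∀ (i : Fin 3) (k : ℕ),
      Measurable fun t : ℝ => discreteEntries μ x₀ ⌊t * n k⌋₊ i := fun i k =>
    (measurable_from_nat (f := fun l => discreteEntries μ x₀ l i)).comp
      (Nat.measurable_floor.comp (measurable_id.mul_const _))
  have hweak : ∀ g : ℝ → Matrix (Fin 2) (Fin 2) ℂ, ContinuousOn g (Set.Icc 0 1) →
      ∀ t ∈ Set.Icc (0 : ℝ) 1, Tendsto (fun k => ∫ s in (0 : ℝ)..t, b ⌊s * n k⌋₊ * g s) atTop
        (𝓝 (∫ s in (0 : ℝ)..t, B s * g s)) := by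
    intro g hg t ht
    have hgi : ∀ i : Fin 3, ContinuousOn (fun s => coefficient (Pi.single i 1) * g s)
      (Set.Icc 0 1) := fun i => continuousOn_const.mul hg
    have hsplit : ∀ u : ℝ → Fin 3 → ℝ, (∀ i, Measurable fun s => u s i) → (∀ s i, |u s i| ≤ M) →
        ∫ s in (0 : ℝ)..t, coefficient (u s) * g s =
          ∑ i, ∫ s in (0 : ℝ)..t, u s i • (coefficient (Pi.single i 1) * g s) := by
      intro u hu hb'
      rw [← intervalIntegral.integral_finsetSum]
      · refine intervalIntegral.integral_congr fun s _ => ?_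
        rw [coefficient_eq_sum (u s), Finset.sum_mul]
        simp_rw [smul_mul_assoc]
      · intro i _
        rw [intervalIntegrable_iff_integrableOn_Icc_of_le ht.1]
        exact (((hgi i).mono (Set.Icc_subset_Icc_right ht.2)).integrableOn_compact
          isCompact_Icc).bdd_smul M (hu i).aestronglyMeasurable
          (ae_of_all _ fun s => hb' s i)
    have e := tendsto_finsetSum Finset.univ fun i (_ : i ∈ Finset.univ) =>
      tendsto_integral_smul_of_weak (hfm i) (fun k s => abs_discreteEntries_le hM _ i) (hm i)
        (fun s => hb s i) (hlim i) (hgi i) ht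
    rw [← hsplit h hm hb] at e
    exact e.congr fun k => (hsplit (fun s => discreteEntries μ x₀ ⌊s * n k⌋₊) (fun i => hfm i k)
      (fun s i => abs_discreteEntries_le hM _ i)).symm
  have hcont : ∀ a, ContinuousOn (evolution B a) (Set.Icc 0 1) :=
    continuousOn_evolution hBm hBC hC0
  refine ⟨n, fun t => hamiltonian (h t), fun a => evolution B a, C, hn, hn0, ?_, ?_, ?_, ?_, ?_, ?_,
    ?_, ?_⟩
  · intro i j
    fin_cases i <;> fin_cases j <;> simp only [hamiltonian, Fin.zero_eta, Fin.mk_one,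
      Matrix.of_apply, Matrix.cons_val_zero, Matrix.cons_val_one]
    exacts [measurable_ofReal.comp (hm 0), measurable_ofReal.comp (hm 1),
      measurable_ofReal.comp (hm 1), measurable_ofReal.comp (hm 2)]
  · intro t i j
    fin_cases i <;> fin_cases j <;> simp [hamiltonian, hb]
  · have hpsd := ae_form_nonneg (f := fun k t => discreteEntries μ x₀ ⌊t * n k⌋₊)
      (fun k i => hfm i k) (fun k t i => abs_discreteEntries_le hM _ i) hm hb
      (fun k t x y => discreteEntries_form_nonneg μ x₀ _ x y) hlim
    filter_upwards [hpsd] with t ht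
    exact posSemidef_hamiltonian ht
  · intro a
    refine ⟨fun i j => ?_, ?_, ?_⟩
    · obtain ⟨C', hC'⟩ := isCompact_Icc.exists_bound_of_continuousOn (hcont a)
      have hC'0 : 0 ≤ C' := (norm_nonneg _).trans (hC' 0 (by simp))
      have hLip : LipschitzOnWith (Real.toNNReal (‖a‖ * (C * C')))
          (fun t => evolution B a t i j) (Set.uIcc 0 1) := by
        refine LipschitzOnWith.of_dist_le_mul fun t ht s hs => ?_
        rw [Set.uIcc_of_le zero_le_one] at ht hs
        rw [dist_eq_norm, ← Matrix.sub_apply, Real.coe_toNNReal _ (by positivity), mul_assoc,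
          Real.dist_eq]
        refine (norm_entry_le _ i j).trans ?_
        rw [evolution_eq hBm hBC hC0 a ht, evolution_eq hBm hBC hC0 a hs, add_sub_add_left_eq_sub,
          ← smul_sub, norm_smul]
        exact mul_le_mul_of_nonneg_left
          (norm_integral_mul_sub_le hBm hBC hC0 (hcont a) hC' hs ht) (norm_nonneg a)
      exact hLip.absolutelyContinuousOnInterval
    · filter_upwards [ae_hasDerivAt_evolution hBm hBC a] with t ht
      exact ⟨_, hasDerivAt_matrix_iff.1 ht, (matJ_mul_eq_iff _ _ _ _).2 rfl⟩
    · simp only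
      rw [evolution_eq hBm hBC hC0 a (by simp), intervalIntegral.integral_same, smul_zero, add_zero]
  · intro a R hR
    have hAC := absolutelyContinuousOnInterval_matrix hR.absCont
    have hRc : ContinuousOn R (Set.Icc 0 1) := by
      have := hAC.continuousOn
      rwa [Set.uIcc_of_le zero_le_one] at this
    refine eqOn_of_volterra hBm hBC a hRc (hcont a) ?_ fun t ht => evolution_eq hBm hBC hC0 a ht
    refine eq_one_add_integral_of_ae_hasDerivAt hBm hBC a hAC hR.init ?_
    filter_upwards [hR.eqn] with t ⟨D, hD, hDe⟩
    rw [matJ_mul_eq_iff] at hDe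
    rw [← hDe]
    exact hasDerivAt_matrix_iff.2 hD
  · intro a ε hε
    have := tendsto_discrete_evolution hBm hBC hbC hn.tendsto_atTop hn0 hweak a
      (P := fun k l => discreteQ μ x₀ (a / (n k : ℂ)) l) (fun k => rfl)
      (fun k l => discreteQ_succ μ x₀ _ l) hε
    filter_upwards [this] with k hk t ht i j
    exact (norm_entry_le _ i j).trans_lt (hk t ht)
  · intro i j
    exact (entryCLM i j).differentiable.comp (differentiable_evolution hBC hC0 (by simp))
  · intro z N i j
    exact (norm_entry_le _ i j).trans
      (norm_discrete_le hbC (P := discreteQ μ x₀ z) rfl (discreteQ_succ μ x₀ z) N)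

end ScalingLimit

/-! ### Entrywise uniform limits, and limits at the centre of a circle -/

section Limits

lemma tendstoUniformlyOn_matrix {F : ℕ → ℝ → Matrix (Fin 2) (Fin 2) ℂ}
    {f : ℝ → Matrix (Fin 2) (Fin 2) ℂ} {s : Set ℝ}
    (h : ∀ ε > 0, ∀ᶠ k in atTop, ∀ t ∈ s, ∀ i j, ‖F k t i j - f t i j‖ < ε) :
    TendstoUniformlyOn F f atTop s := by
  rw [tendstoUniformlyOn_iff_tendsto, Matrix.uniformity, tendsto_iInf]
  intro i
  rw [tendsto_iInf]
  intro j
  rw [tendsto_comap_iff]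
  have h1 : TendstoUniformlyOn (fun k t => F k t i j) (fun t => f t i j) atTop s := by
    rw [Metric.tendstoUniformlyOn_iff]
    intro ε hε
    filter_upwards [h ε hε] with k hk t ht
    rw [dist_comm, dist_eq_norm]
    exact hk t ht i j
  exact tendstoUniformlyOn_iff_tendsto.1 h1

/-- Pointwise limits of bounded families of entire functions on a circle determine the limit at
the center. -/
lemma tendsto_center_of_tendsto_circle {f : ℕ → ℂ → ℂ} {g : ℂ → ℂ} {a : ℂ} {C : ℝ}
    (hf : ∀ k, Differentiable ℂ (f k)) (hg : Differentiable ℂ g)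
    (hC : ∀ k, ∀ z ∈ Metric.sphere a 1, ‖f k z‖ ≤ C)
    (hlim : ∀ z ∈ Metric.sphere a 1, Tendsto (fun k => f k z) atTop (𝓝 (g z))) :
    Tendsto (fun k => f k a) atTop (𝓝 (g a)) := by
  have hmean : ∀ F : ℂ → ℂ, Differentiable ℂ F → Real.circleAverage F a 1 = F a := fun F hF =>
    hF.diffContOnCl.circleAverage
  have hs : ∀ θ, circleMap a 1 θ ∈ Metric.sphere a 1 := fun θ =>
    circleMap_mem_sphere a zero_le_one θ
  rw [← hmean g hg]
  simp_rw [← fun k => hmean (f k) (hf k)]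
  simp only [Real.circleAverage]
  refine Tendsto.const_smul ?_ _
  refine intervalIntegral.tendsto_integral_filter_of_dominated_convergence (fun _ => C) ?_ ?_ ?_ ?_
  · exact Eventually.of_forall fun k =>
      ((hf k).continuous.comp (continuous_circleMap a 1)).aestronglyMeasurable
  · exact Eventually.of_forall fun k => ae_of_all _ fun θ _ => hC k _ (hs θ)
  · exact intervalIntegrable_const
  · exact ae_of_all _ fun θ _ => hlim _ (hs θ)

end Limits

end CDScaling

/-! ### The main theorem -/

open CDScaling
theorem mainTheorem1 (μ : Measure ℝ) [IsFiniteMeasure μ]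
    (hcompact : IsCompact μ.support) (hinf : μ.support.Infinite) (x₀ : ℝ)
    (hbdd : BddAbove (Set.range fun l : ℕ =>
      (orthPoly μ l).eval x₀ ^ 2 + secondKind μ l x₀ ^ 2)) :
    ∃ (n : ℕ → ℕ) (H : ℝ → Matrix (Fin 2) (Fin 2) ℂ)
      (Q : ℂ → ℝ → Matrix (Fin 2) (Fin 2) ℂ) (KH : ℂ → ℂ → ℂ),
      StrictMono n ∧ (∀ k, 0 < n k) ∧
      -- `H` is measurable, bounded, and nonnegative almost everywhere on `[0, 1]`
      (∀ i j, Measurable fun t => H t i j) ∧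
      (∃ M : ℝ, ∀ t ∈ Set.Icc (0 : ℝ) 1, ∀ i j, ‖H t i j‖ ≤ M) ∧
      (∀ᵐ t ∂(volume.restrict (Set.Icc (0 : ℝ) 1)), (H t).PosSemidef) ∧
      -- `Q a` is the solution of the canonical system, and the limit of the discrete solutions
      (∀ a : ℂ, IsCanonicalSolution H a (Q a) ∧
        (∀ R, IsCanonicalSolution H a R → Set.EqOn R (Q a) (Set.Icc 0 1)) ∧
        TendstoUniformlyOn
          (fun k t => discreteQ μ x₀ (a / (n k : ℂ)) ⌊t * (n k : ℝ)⌋₊)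
          (Q a) atTop (Set.Icc (0 : ℝ) 1)) ∧
      -- the limit `KH` of the scaled Christoffel-Darboux kernels
      (∀ a b : ℂ, Tendsto
        (fun k => cdKernel μ (n k) (x₀ + a / (n k : ℂ)) (x₀ + b / (n k : ℂ)) / (n k : ℂ))
        atTop (𝓝 (KH a b))) ∧
      (∀ a b : ℂ, a ≠ b → KH a b = (a - b)⁻¹ * detFirstCols (Q a 1) (Q b 1)) ∧
      -- `(a, b) ↦ KH (conj a) b` is the reproducing kernel of the de Branges space of the system
      IsHermiteBiehler (hermiteBiehlerFun Q) ∧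
      IsReproducingKernel (hermiteBiehlerFun Q) (fun a b => KH (conj a) b) := by
  obtain ⟨M, hM⟩ := hbdd
  obtain ⟨n, H, Q, C, hn, hn0, hHm, hHM, hpsd, hsol, huniq, hlim, hdiff, hbound⟩ :=
    exists_scalingLimit (μ := μ) (x₀ := x₀) (M := M) fun l => hM ⟨l, rfl⟩
  set D : ℂ → ℂ → ℂ := fun a b => detFirstCols (Q a 1) (Q b 1) with hD
  -- As `D a` is entire and vanishes at `a`, its divided difference is entire and supplies the
  -- diagonal values. The sign changes the denominator `b - a` into `a - b`.
  set KH : ℂ → ℂ → ℂ := fun a b => -dslope (D a) a b with hKH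
  have hDdiff : ∀ a, Differentiable ℂ (D a) := fun a => by
    simp only [hD, detFirstCols_eq]
    exact ((hdiff 1 0).const_mul _).sub ((hdiff 0 0).const_mul _)
  have hKdiff : ∀ a, Differentiable ℂ (KH a) := fun a => by
    have h := (differentiableOn_dslope (c := a) univ_mem).2 (hDdiff a).differentiableOn
    exact (differentiableOn_univ.1 h).neg
  have hDaa : ∀ a, D a a = 0 := fun a => by
    simp only [hD, detFirstCols_eq]
    ring
  have hker : ∀ a z, (a - z) * KH a z = D a z := fun a z => by
    have h := sub_smul_dslope (D a) a z
    rw [hDaa, sub_zero, smul_eq_mul] at h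
    rw [← h, hKH]
    ring
  have hKne : ∀ a b, a ≠ b → KH a b = (a - b)⁻¹ * D a b := fun a b hab => by
    rw [← hker, inv_mul_cancel_left₀ (sub_ne_zero.2 hab)]
  have hnk : ∀ k, (n k : ℂ) ≠ 0 := fun k => by exact_mod_cast (hn0 k).ne'
  -- convergence of the entries at `t = 1`
  have hone : ∀ a i j, Tendsto (fun k => discreteQ μ x₀ (a / (n k : ℂ)) (n k) i j) atTop
      (𝓝 (Q a 1 i j)) := fun a i j => by
    rw [Metric.tendsto_nhds]
    intro ε hε
    filter_upwards [hlim a ε hε] with k hk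
    have h := hk 1 (by simp) i j
    rwa [one_mul, Nat.floor_natCast, ← dist_eq_norm] at h
  have hcd : ∀ k a b, (a - b) *
      (cdKernel μ (n k) (x₀ + a / (n k : ℂ)) (x₀ + b / (n k : ℂ)) / (n k : ℂ)) =
      detFirstCols (discreteQ μ x₀ (a / (n k : ℂ)) (n k))
        (discreteQ μ x₀ (b / (n k : ℂ)) (n k)) := fun k a b => by
    rw [← sub_mul_cdKernel x₀ hcompact hinf]
    ring
  have hKlim_ne : ∀ a b, a ≠ b → Tendsto
      (fun k => cdKernel μ (n k) (x₀ + a / (n k : ℂ)) (x₀ + b / (n k : ℂ)) / (n k : ℂ))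
      atTop (𝓝 (KH a b)) := by
    intro a b hab
    have hab' := sub_ne_zero.2 hab
    have h1 : Tendsto (fun k => detFirstCols (discreteQ μ x₀ (a / (n k : ℂ)) (n k))
        (discreteQ μ x₀ (b / (n k : ℂ)) (n k))) atTop (𝓝 (D a b)) := by
      simp only [hD, detFirstCols_eq]
      exact ((hone a 0 0).mul (hone b 1 0)).sub ((hone a 1 0).mul (hone b 0 0))
    rw [hKne a b hab]
    refine (h1.const_mul (a - b)⁻¹).congr fun k => ?_
    rw [← hcd, inv_mul_cancel_left₀ hab']
  have hKlim : ∀ a b, Tendsto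
      (fun k => cdKernel μ (n k) (x₀ + a / (n k : ℂ)) (x₀ + b / (n k : ℂ)) / (n k : ℂ))
      atTop (𝓝 (KH a b)) := by
    intro a b
    rcases eq_or_ne a b with rfl | hab
    swap
    · exact hKlim_ne a b hab
    -- The diagonal case: on the circle `‖z - a‖ = 1` the factor `a - z` has modulus one, so the
    -- scaled kernel has the modulus of a `2 × 2` determinant and is bounded uniformly in `k`.
    -- Convergence on the circle then passes to its centre.
    have hEntry : ∀ k (z : ℂ), ‖z‖ ≤ ‖a‖ + 1 → ∀ i j,
        ‖discreteQ μ x₀ (z / (n k : ℂ)) (n k) i j‖ ≤ Real.exp ((‖a‖ + 1) * |C|) := by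
      intro k z hz i j
      refine (hbound _ _ i j).trans (Real.exp_le_exp.2 ?_)
      have hN : (0 : ℝ) < n k := by exact_mod_cast hn0 k
      rw [norm_div, Complex.norm_natCast]
      calc (n k : ℝ) * (‖z‖ / n k * C) = ‖z‖ * C := by field_simp
        _ ≤ ‖z‖ * |C| := mul_le_mul_of_nonneg_left (le_abs_self C) (norm_nonneg z)
        _ ≤ (‖a‖ + 1) * |C| := mul_le_mul_of_nonneg_right hz (abs_nonneg C)
    refine tendsto_center_of_tendsto_circle (a := a) (g := KH a)
      (f := fun k z => cdKernel μ (n k) (x₀ + a / (n k : ℂ)) (x₀ + z / (n k : ℂ)) / (n k : ℂ))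
      (C := 2 * Real.exp ((‖a‖ + 1) * |C|) ^ 2) (fun k => ?_) (hKdiff a) (fun k z hz => ?_)
      fun z hz => ?_
    · simp only [cdKernel]
      refine Differentiable.div_const (Differentiable.fun_sum fun j _ => ?_) _
      refine Differentiable.const_mul ?_ _
      have h1 : Differentiable ℂ fun w : ℂ => aeval w (orthPoly μ j) :=
        Polynomial.differentiable_aeval _
      exact h1.comp (by fun_prop)
    · have hz1 : ‖a - z‖ = 1 := by
        rw [norm_sub_rev]
        simpa [dist_eq_norm] using hz
      have hzn : ‖z‖ ≤ ‖a‖ + 1 := by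
        have := norm_sub_norm_le z a
        rw [norm_sub_rev, hz1] at this
        linarith
      have h1 := congrArg norm (hcd k a z)
      rw [norm_mul, hz1, one_mul, detFirstCols_eq] at h1
      rw [h1]
      refine (norm_sub_le _ _).trans ?_
      rw [norm_mul, norm_mul]
      have e1 := hEntry k a (by linarith)
      have e2 := hEntry k z hzn
      have m1 := mul_le_mul (e1 0 0) (e2 1 0) (norm_nonneg _) (Real.exp_pos _).le
      have m2 := mul_le_mul (e1 1 0) (e2 0 0) (norm_nonneg _) (Real.exp_pos _).le
      rw [pow_two]
      linarith
    · refine hKlim_ne a z fun h => ?_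
      subst h
      simp at hz
  have hQconj : ∀ z i j, Q (conj z) 1 i j = conj (Q z 1 i j) := by
    intro z i j
    refine tendsto_nhds_unique (hone (conj z) i j) ?_
    refine ((continuous_conj.tendsto _).comp (hone z i j)).congr fun k => ?_
    rw [Function.comp_apply, ← discreteQ_conj, map_div₀, conj_natCast]
  have hpair : IsKernelPair (fun z => Q z 1 0 0) (fun z => Q z 1 1 0) KH := by
    refine ⟨hdiff 0 0, hdiff 1 0, fun z => hQconj z 0 0, fun z => hQconj z 1 0, fun z => ?_,
      fun z hz => ?_, hKdiff, fun a b => ?_, fun a z => ?_⟩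
    -- The limit matrix has determinant `1`, so its first column is nonzero.
    · by_contra hc
      push Not at hc
      have h1 : Tendsto (fun k => (discreteQ μ x₀ (z / (n k : ℂ)) (n k)).det) atTop
          (𝓝 (Q z 1 0 0 * Q z 1 1 1 - Q z 1 0 1 * Q z 1 1 0)) := by
        simp only [Matrix.det_fin_two]
        exact ((hone z 0 0).mul (hone z 1 1)).sub ((hone z 0 1).mul (hone z 1 0))
      simp only [det_discreteQ] at h1
      have h2 := tendsto_nhds_unique h1 tendsto_const_nhds
      rw [hc.1, hc.2] at h2
      simp at h2
    -- Since `D z (conj z) = 2i Im (A z conj (B z))` and `z - conj z = 2i Im z`, the kernel identity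
    -- gives `Im (A conj B) = Im z * Re KH z (conj z)`.
    · have hre : 0 ≤ (KH z (conj z)).re := by
        refine ge_of_tendsto ((continuous_re.tendsto _).comp (hKlim z (conj z)))
          (Eventually.of_forall fun k => ?_)
        have h1 : (x₀ : ℂ) + conj z / (n k : ℂ) = conj (x₀ + z / (n k : ℂ)) := by simp
        have h2 := cdKernel_conj_nonneg (μ := μ) (n k) (x₀ + z / (n k : ℂ))
        rw [Function.comp_apply, h1, div_natCast_re]
        exact div_nonneg (Complex.le_def.1 h2).1 (Nat.cast_nonneg _)
      have h := hker z (conj z)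
      simp only [hD, detFirstCols_eq, hQconj] at h
      have him := congrArg im h
      simp only [mul_im, sub_re, sub_im, conj_re, conj_im, sub_self, zero_mul, zero_add] at him
      simp only [mul_im, conj_re, conj_im]
      nlinarith [mul_nonneg hz hre]
    · refine tendsto_nhds_unique (hKlim (conj a) (conj b)) ?_
      refine ((continuous_conj.tendsto _).comp (hKlim a b)).congr fun k => ?_
      rw [Function.comp_apply, map_div₀, conj_natCast]
      congr 1
      simp only [cdKernel, map_sum, map_mul, ← aeval_conj, map_add, map_div₀, conj_ofReal,
        conj_natCast]
    · rw [hker]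
      simp only [hD, detFirstCols_eq]
  exact ⟨n, H, Q, KH, hn, hn0, hHm, ⟨M, fun t _ => hHM t⟩, hpsd, fun a => ⟨hsol a, huniq a,
    tendstoUniformlyOn_matrix (hlim a)⟩, hKlim, hKne, hpair.isHermiteBiehler,
    hpair.isReproducingKernel⟩
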